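/- Let $n\ge 1$ and let $G\sim\mathbb G(n,\tfrac12)$ be a random graph on the vertex set $[n]$. Put $A_{ij}=1$ if $\{i,j\}$ is an edge of $G$, $A_{ij}=-1$ if $i\ne j$ and $\{i,j\}$ is not an edge, and $A_{ii}=0$. Consider the Euclidean space $\mathbb R^{\binom n2}$ of real vectors indexed by the unordered pairs of distinct elements of $[n]$. Let $a_1,\dots,a_n\in\mathbb R^{\binom n2}$ be given by $a_i(\{k,\ell\})=A_{ik}A_{i\ell}$, let $D_i=\mathrm{diag}(a_i)$, let $W=\mathrm{span}\{a_1,\dots,a_n\}$, and let $\Pi_W$ be the orthogonal projection to $W$. Let $V_0=\mathrm{span}\{\mathbb 1\}$, where $\mathbb 1$ is the all-ones vector, let $V_1$ be the span of the vectors $u$ with $\langle u,\mathbb 1\rangle=0$ for which there is an $x\in\mathbb R^n$ with $u(\{k,\ell\})=x_k+x_\ell$ for all $k\neq \ell$, let $V_2$ be the orthogonal complement of $V_0+V_1$ in $\mathbb R^{\binom n2}$, and let $\Pi_0$, $\Pi_2$ be the orthogonal projections to $V_0$, $V_2$. Then there are absolute constants $C_0,C_1,C_2$ such that for every $n\ge1$,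 with probability at least $1-C_0n^{-5}$, \[ \sum_{i=1}^n D_i\,\Pi_2\,\Pi_W\,\Pi_2\,D_i\ \preceq\ C_1 n\cdot\Pi_0+C_2\log^2 n\cdot\mathrm{Id}, \] where $\mathrm{Id}$ is the identity on $\mathbb R^{\binom n2}$ and $\preceq$ is the positive semidefinite order. -/

import Mathlib

namespace PlantedClique

noncomputable section

/-- Unordered pairs `{k, l}` of distinct elements of `[n]`. -/
abbrev Pairs (n : ℕ) : Type := {e : Sym2 (Fin n) // ¬ e.IsDiag}

/-- The Euclidean space of real vectors indexed by unordered pairs of distinct vertices. -/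
abbrev PairSpace (n : ℕ) : Type := EuclideanSpace ℝ (Pairs n)

open scoped Classical in
/-- The centered adjacency matrix: `A i j` is `1` on edges, `-1` on non-edges, `0` if `i = j`. -/
def signedAdj {n : ℕ} (G : SimpleGraph (Fin n)) (i j : Fin n) : ℝ :=
  if i = j then 0 else if G.Adj i j then 1 else -1

/-- The vector `a i`, with entry `A i k * A i l` at `{k, l}`. -/
def starVec {n : ℕ} (G : SimpleGraph (Fin n)) (i : Fin n) : PairSpace n :=
  WithLp.toLp 2 fun e : Pairs n =>
    Sym2.lift ⟨fun k l => signedAdj G i k * signedAdj G i l, fun _ _ => mul_comm _ _⟩ e.1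

/-- `D i = diag (a i)`. -/
def starDiag {n : ℕ} (G : SimpleGraph (Fin n)) (i : Fin n) : PairSpace n →L[ℝ] PairSpace n :=
  Matrix.toEuclideanCLM (𝕜 := ℝ) (Matrix.diagonal fun e : Pairs n => starVec G i e)

/-- `W = span {a 1, ..., a n}`. -/
def spaceW {n : ℕ} (G : SimpleGraph (Fin n)) : Submodule ℝ (PairSpace n) :=
  Submodule.span ℝ (Set.range (starVec G))

/-- The all-ones vector. -/
def onesVec (n : ℕ) : PairSpace n := WithLp.toLp 2 fun _ => 1

/-- `V₀`, the span of the all-ones vector. -/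
def spaceV0 (n : ℕ) : Submodule ℝ (PairSpace n) := Submodule.span ℝ {onesVec n}

/-- `V₁`, spanned by the vectors orthogonal to the all-ones vector whose entry at `{i, j}` is
`x i + x j` for some `x : [n] → ℝ`. -/
def spaceV1 (n : ℕ) : Submodule ℝ (PairSpace n) :=
  Submodule.span ℝ {u | inner ℝ u (onesVec n) = 0 ∧
    ∃ x : Fin n → ℝ, ∀ (i j : Fin n) (h : ¬ (s(i, j) : Sym2 (Fin n)).IsDiag),
      u ⟨s(i, j), h⟩ = x i + x j}

/-- `V₂`, the orthogonal complement of `V₀ + V₁`. -/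
def spaceV2 (n : ℕ) : Submodule ℝ (PairSpace n) := (spaceV0 n ⊔ spaceV1 n)ᗮ

/-- The orthogonal projection to `V₀`. -/
def proj0 (n : ℕ) : PairSpace n →L[ℝ] PairSpace n := (spaceV0 n).starProjection

/-- The orthogonal projection to `V₂`. -/
def proj2 (n : ℕ) : PairSpace n →L[ℝ] PairSpace n := (spaceV2 n).starProjection

/-- The orthogonal projection to `W`. -/
def projW {n : ℕ} (G : SimpleGraph (Fin n)) : PairSpace n →L[ℝ] PairSpace n :=
  (spaceW G).starProjection

/-- The probability `1/2` as an element of the unit interval. -/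
def half : unitInterval := ⟨1 / 2, by norm_num, by norm_num⟩

/-- The law of the random graph `𝔾(n, 1/2)`. -/
def randomGraph (n : ℕ) : MeasureTheory.Measure (SimpleGraph (Fin n)) :=
  SimpleGraph.binomialRandom (Fin n) half

end

end PlantedClique

/-! The quadratic form of the left side at `u` is `∑ i, ‖Π_W Π₂ D_i u‖²`. Once the Gram matrix of
the `a_j` is at least `n²/8`, one has `‖Π_W z‖² ≤ (8/n²) ∑ j, ⟨a_j, z⟩²` (`norm_projW_sq_le`), so it
suffices to bound `∑ i, ∑ j, ⟨a_j, Π₂ D_i u⟩²`. Write `Π₂ = Id - Q` with `Q` the projection to `V₀ +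
V₁`. For `Id` and `i ≠ j` the sum is that of `⟨a_i ∘ a_j, u⟩²`, of order `n² log² n ‖u‖²`. For `i =
j` the vector `a_i ∘ a_i` is the all-ones vector up to the pairs containing `i`, and this alone
produces the term `n Π₀`. The range of `Q` consists of vectors `x_k + x_l`, on which `⟨a_j, ·⟩` is
expressed by the row sums of `A` and by `A x`; row sums and operator norm of size `√(n log n)`
suffice. `sum_norm_projW_sq_le` assembles these deterministic bounds.

The four random inputs (norm of `A`, row sums, the vectors `a_i ∘ a_j`, the off-diagonal Gram form)
are moment bounds plus Markov. Row sums are scalar; the others rest on a matrix Rosenthal inequality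
for traces of powers, `expect_trace_sum_pow_le`, proved by induction on the power. The edges are not
independent row by row because `A` is symmetric, so vertices get one of three colors: with `i` of
color 0, `j` of color 1 and the pair inside color 2, the entries used are distinct edges and embed
into two independent sign matrices (`Agree`, `expect_graph_le`). Averaging over colorings recovers
the original quantities up to factors 9 and 81. -/

namespace PlantedClique

open Matrix Finset
open scoped BigOperators

/-! ### Trace inequalities for powers of positive semidefinite matrices -/

section MatrixTrace

variable {ι : Type*} [Fintype ι] [DecidableEq ι]

/-- Orthogonal diagonalization of a positive semidefinite real matrix. -/
lemma exists_diagonalization {A : Matrix ι ι ℝ} (hA : A.PosSemidef) :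
    ∃ (V : Matrix ι ι ℝ) (d : ι → ℝ), (∀ i, 0 ≤ d i) ∧ V * Vᵀ = 1 ∧ Vᵀ * V = 1 ∧
      A = V * diagonal d * Vᵀ := by
  refine ⟨hA.1.eigenvectorUnitary, hA.1.eigenvalues, hA.eigenvalues_nonneg, ?_, ?_, ?_⟩
  · have := Unitary.coe_mul_star_self hA.1.eigenvectorUnitary
    simpa [star_eq_conjTranspose] using this
  · have := Unitary.coe_star_mul_self hA.1.eigenvectorUnitary
    simpa [star_eq_conjTranspose] using this
  · have := hA.1.spectral_theorem
    rw [Unitary.conjStarAlgAut_apply] at this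
    simpa [star_eq_conjTranspose, Function.comp_def] using this

lemma conj_diagonal_pow {V : Matrix ι ι ℝ} (hV : Vᵀ * V = 1) (hV' : V * Vᵀ = 1) (d : ι → ℝ)
    (k : ℕ) :
    (V * diagonal d * Vᵀ) ^ k = V * diagonal (fun i => d i ^ k) * Vᵀ := by
  induction k with
  | zero => simp [hV']
  | succ k ih =>
    rw [pow_succ, ih]
    calc V * diagonal (fun i => d i ^ k) * Vᵀ * (V * diagonal d * Vᵀ)
        = V * diagonal (fun i => d i ^ k) * (Vᵀ * V) * diagonal d * Vᵀ := by
          simp only [Matrix.mul_assoc]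
      _ = V * (diagonal (fun i => d i ^ k) * diagonal d) * Vᵀ := by
          rw [hV, Matrix.mul_one, Matrix.mul_assoc V]
      _ = _ := by rw [diagonal_mul_diagonal]; simp only [pow_succ]

lemma conj_diagonal_add {V : Matrix ι ι ℝ} (hV' : V * Vᵀ = 1) (d : ι → ℝ) (L : ℝ) :
    V * diagonal d * Vᵀ + L • (1 : Matrix ι ι ℝ) = V * diagonal (fun i => d i + L) * Vᵀ := by
  have : diagonal (fun i => d i + L) = diagonal d + L • (1 : Matrix ι ι ℝ) := by
    rw [← diagonal_one, ← diagonal_smul, diagonal_add]; simp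
  rw [this, Matrix.mul_add, Matrix.add_mul, Matrix.mul_smul, Matrix.mul_one, Matrix.smul_mul, hV']

lemma trace_mul_conj_diagonal (X V : Matrix ι ι ℝ) (f : ι → ℝ) :
    trace (X * (V * diagonal f * Vᵀ)) = ∑ i, (Vᵀ * X * V) i i * f i := by
  have : trace (X * (V * diagonal f * Vᵀ)) = trace (Vᵀ * X * V * diagonal f) := by
    rw [← Matrix.mul_assoc, Matrix.trace_mul_comm]; simp only [Matrix.mul_assoc]
  rw [this]; simp [trace, mul_diagonal]

lemma trace_mul_conj_diagonal_mul_conj_diagonal (X V : Matrix ι ι ℝ) (f g : ι → ℝ) :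
    trace (X * (V * diagonal f * Vᵀ) * X * (V * diagonal g * Vᵀ)) =
      ∑ i, ∑ j, (Vᵀ * X * V) i j * (Vᵀ * X * V) j i * (f j * g i) := by
  have : trace (X * (V * diagonal f * Vᵀ) * X * (V * diagonal g * Vᵀ)) =
      trace ((Vᵀ * X * V * diagonal f) * (Vᵀ * X * V * diagonal g)) := by
    rw [← Matrix.mul_assoc _ (V * diagonal g), Matrix.trace_mul_comm]
    simp only [Matrix.mul_assoc]
  rw [this]
  simp only [trace, Matrix.diag, Matrix.mul_apply (M := Vᵀ * X * V * diagonal f), mul_diagonal]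
  exact sum_congr rfl fun i _ => sum_congr rfl fun j _ => by ring

lemma trace_mul_nonneg {A B : Matrix ι ι ℝ} (hA : A.PosSemidef) (hB : B.PosSemidef) :
    0 ≤ trace (A * B) := by
  obtain ⟨V, d, hd, -, -, rfl⟩ := exists_diagonalization hB
  rw [trace_mul_conj_diagonal]
  refine sum_nonneg fun i _ => mul_nonneg ?_ (hd i)
  have := hA.conjTranspose_mul_mul_same V
  exact (by simpa using this : (Vᵀ * A * V).PosSemidef).diag_nonneg

lemma trace_mul_le_trace_mul {A B C : Matrix ι ι ℝ} (hAB : (B - A).PosSemidef)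
    (hC : C.PosSemidef) : trace (A * C) ≤ trace (B * C) := by
  have := trace_mul_nonneg hAB hC
  rw [Matrix.sub_mul, trace_sub] at this
  linarith

lemma posSemidef_smul_sub_sq {X : Matrix ι ι ℝ} (hX : X.PosSemidef) {L : ℝ}
    (hL : (L • (1 : Matrix ι ι ℝ) - X).PosSemidef) : (L • X - X * X).PosSemidef := by
  obtain ⟨V, d, hd, h1, h2, rfl⟩ := exists_diagonalization hX
  have hdL : ∀ i, d i ≤ L := fun i => by
    have := hL.conjTranspose_mul_mul_same V
    have h3 : Vᴴ * (L • (1 : Matrix ι ι ℝ) - V * diagonal d * Vᵀ) * V =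
        L • (1 : Matrix ι ι ℝ) - diagonal d := by
      simp only [conjTranspose_eq_transpose_of_trivial, Matrix.mul_sub, Matrix.sub_mul,
        Matrix.mul_smul, Matrix.smul_mul, Matrix.mul_one, h2]
      congr 1
      calc Vᵀ * (V * diagonal d * Vᵀ) * V = (Vᵀ * V) * diagonal d * (Vᵀ * V) := by
            simp only [Matrix.mul_assoc]
        _ = _ := by simp [h2]
    rw [h3] at this
    have := this.diag_nonneg (i := i)
    simpa using this
  have h4 : L • (V * diagonal d * Vᵀ) - V * diagonal d * Vᵀ * (V * diagonal d * Vᵀ) =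
      V * diagonal (fun i => L * d i - d i ^ 2) * Vᴴ := by
    rw [← sq, conj_diagonal_pow h2 h1, ← Matrix.smul_mul, ← Matrix.mul_smul, ← Matrix.sub_mul,
      ← Matrix.mul_sub, ← diagonal_smul, diagonal_sub]
    simp
  rw [h4]
  refine (PosSemidef.diagonal fun i => ?_).mul_mul_conjTranspose_same V
  have := hd i
  have := hdL i
  simp only [Pi.zero_apply]
  nlinarith

lemma mul_pow_add_mul_pow_le {x y : ℝ} (hx : 0 ≤ x) (hy : 0 ≤ y) (a b : ℕ) :
    x ^ a * y ^ b + x ^ b * y ^ a ≤ x ^ (a + b) + y ^ (a + b) := by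
  have : 0 ≤ (x ^ a - y ^ a) * (x ^ b - y ^ b) := by
    rcases le_total x y with h | h
    · exact mul_nonneg_of_nonpos_of_nonpos (sub_nonpos.2 (pow_le_pow_left₀ hx h a))
        (sub_nonpos.2 (pow_le_pow_left₀ hx h b))
    · exact mul_nonneg (sub_nonneg.2 (pow_le_pow_left₀ hy h a))
        (sub_nonneg.2 (pow_le_pow_left₀ hy h b))
  rw [pow_add, pow_add]
  linarith

lemma two_mul_sum_range_pow_mul_pow_le {x y : ℝ} (hx : 0 ≤ x) (hy : 0 ≤ y) (q : ℕ) :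
    2 * ∑ a ∈ range q, x ^ a * y ^ (q - 1 - a) ≤ q * (x ^ (q - 1) + y ^ (q - 1)) := by
  have h := sum_range_reflect (fun a => x ^ a * y ^ (q - 1 - a)) q
  rw [two_mul]
  nth_rw 1 [← h]
  rw [← sum_add_distrib]
  calc _ ≤ ∑ _a ∈ range q, (x ^ (q - 1) + y ^ (q - 1)) := by
        refine sum_le_sum fun a ha => ?_
        have ha := mem_range.1 ha
        have := mul_pow_add_mul_pow_le hx hy (q - 1 - a) a
        rw [show q - 1 - a + a = q - 1 by omega] at this
        rwa [show q - 1 - (q - 1 - a) = a by omega]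
    _ = _ := by simp [mul_add]

/-- For `0 ≤ X ≤ L` and `0 ≤ U`, the mixed traces are bounded by a single commuting one. -/
lemma sum_trace_mul_pow_mul_mul_pow_le {X U : Matrix ι ι ℝ} (hX : X.PosSemidef)
    (hU : U.PosSemidef) {L : ℝ} (hL : (L • (1 : Matrix ι ι ℝ) - X).PosSemidef) (q : ℕ) :
    ∑ a ∈ range q, trace (X * U ^ a * X * U ^ (q - 1 - a)) ≤ q * (L * trace (X * U ^ (q - 1))) := by
  have h0 : trace (X * X * U ^ (q - 1)) ≤ L * trace (X * U ^ (q - 1)) := by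
    have := trace_mul_le_trace_mul (posSemidef_smul_sub_sq hX hL) (hU.pow (q - 1))
    simpa using this
  refine le_trans ?_ (mul_le_mul_of_nonneg_left h0 (Nat.cast_nonneg q))
  -- In an eigenbasis of `U`, with `Y = Vᵀ X V` symmetric, each mixed trace is a sum of `Y i j ^ 2`
  -- times a monomial in `d i` and `d j`, so the scalar inequality for each pair of eigenvalues
  -- suffices. The remaining passage from `X * X` to `L • X` is `h0`.
  obtain ⟨V, d, hd, h1, h2, rfl⟩ := exists_diagonalization hU
  have hsym : ∀ i j, (Vᵀ * X * V) i j = (Vᵀ * X * V) j i := fun i j => by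
    have : (Vᵀ * X * V)ᵀ = Vᵀ * X * V := by
      have hXt : Xᵀ = X := by simpa using hX.1.eq
      simp [Matrix.transpose_mul, hXt, Matrix.mul_assoc]
    rw [← this, transpose_apply, this]
  simp only [conj_diagonal_pow h2 h1]
  have e1 : trace (X * X * (V * diagonal (fun i => d i ^ (q - 1)) * Vᵀ)) =
      ∑ i, ∑ j, (Vᵀ * X * V) i j ^ 2 * d i ^ (q - 1) := by
    have := trace_mul_conj_diagonal_mul_conj_diagonal X V (fun _ => 1) (fun i => d i ^ (q - 1))
    simp only [diagonal_one, Matrix.mul_one, h1, one_mul] at this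
    rw [this]
    refine sum_congr rfl fun i _ => sum_congr rfl fun j _ => ?_
    rw [hsym j i, sq]
  have e1' : trace (X * X * (V * diagonal (fun i => d i ^ (q - 1)) * Vᵀ)) =
      ∑ i, ∑ j, (Vᵀ * X * V) i j ^ 2 * d j ^ (q - 1) := by
    rw [e1, sum_comm]
    exact sum_congr rfl fun i _ => sum_congr rfl fun j _ => by rw [hsym]
  have e2 : 2 * (q * trace (X * X * (V * diagonal (fun i => d i ^ (q - 1)) * Vᵀ))) =
      ∑ i, ∑ j, (Vᵀ * X * V) i j ^ 2 * (q * (d j ^ (q - 1) + d i ^ (q - 1))) := by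
    have : ∀ i j, (Vᵀ * X * V) i j ^ 2 * (q * (d j ^ (q - 1) + d i ^ (q - 1))) =
        q * ((Vᵀ * X * V) i j ^ 2 * d j ^ (q - 1)) + q * ((Vᵀ * X * V) i j ^ 2 * d i ^ (q - 1)) :=
      fun i j => by ring
    simp only [this, sum_add_distrib, ← mul_sum, ← e1, ← e1']
    ring
  simp only [trace_mul_conj_diagonal_mul_conj_diagonal]
  refine le_of_mul_le_mul_left ?_ (zero_lt_two (α := ℝ))
  rw [e2, sum_comm, mul_sum]
  refine sum_le_sum fun i _ => ?_
  rw [sum_comm, mul_sum]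
  refine sum_le_sum fun j _ => ?_
  calc _ = (Vᵀ * X * V) i j ^ 2 * (2 * ∑ a ∈ range q, d j ^ a * d i ^ (q - 1 - a)) := by
        rw [mul_sum, mul_sum, mul_sum]
        refine sum_congr rfl fun a _ => ?_
        rw [hsym j i]; ring
    _ ≤ _ := mul_le_mul_of_nonneg_left (two_mul_sum_range_pow_mul_pow_le (hd j) (hd i) q)
        (sq_nonneg _)

/-- Product rule; `C` and `Y` need not commute, so `Y` appears in each of the `q` positions. Working
entrywise avoids choosing a norm on matrices. -/
lemma hasDerivAt_pow_apply (C Y : Matrix ι ι ℝ) (q : ℕ) (t : ℝ) (i j : ι) :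
    HasDerivAt (fun s : ℝ => ((C + s • Y) ^ q) i j)
      ((∑ a ∈ range q, (C + t • Y) ^ a * Y * (C + t • Y) ^ (q - 1 - a)) i j) t := by
  induction q generalizing i j with
  | zero => simpa using hasDerivAt_const t ((1 : Matrix ι ι ℝ) i j)
  | succ q ih =>
    have hl : ∀ k, HasDerivAt (fun s : ℝ => (C + s • Y) k j) (Y k j) t := fun k => by
      simp only [Matrix.add_apply, Matrix.smul_apply, smul_eq_mul]
      simpa using ((hasDerivAt_id t).mul_const (Y k j)).const_add (C k j)
    have h : HasDerivAt (fun s : ℝ => ∑ k, ((C + s • Y) ^ q) i k * (C + s • Y) k j)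
        (((∑ a ∈ range q, (C + t • Y) ^ a * Y * (C + t • Y) ^ (q - 1 - a)) * (C + t • Y) +
          (C + t • Y) ^ q * Y) i j) t := by
      rw [Matrix.add_apply, Matrix.mul_apply, Matrix.mul_apply, ← sum_add_distrib]
      exact HasDerivAt.fun_sum fun k _ => (ih i k).mul (hl k)
    have e : (fun s : ℝ => ((C + s • Y) ^ (q + 1)) i j) =
        fun s : ℝ => ∑ k, ((C + s • Y) ^ q) i k * (C + s • Y) k j := by
      funext s; rw [pow_succ, Matrix.mul_apply]
    rw [e]
    refine h.congr_deriv ?_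
    have e' : ∀ a ∈ range q, (C + t • Y) ^ a * Y * (C + t • Y) ^ (q - 1 - a) * (C + t • Y) =
        (C + t • Y) ^ a * Y * (C + t • Y) ^ (q - a) := fun a ha => by
      have ha := mem_range.1 ha
      rw [Matrix.mul_assoc, ← pow_succ, show q - 1 - a + 1 = q - a by omega]
    rw [sum_range_succ, Finset.sum_mul, sum_congr rfl e']
    simp only [add_tsub_cancel_right, tsub_self, pow_zero, Matrix.mul_one]

lemma hasDerivAt_trace_mul_pow (Z C Y : Matrix ι ι ℝ) (q : ℕ) (t : ℝ) :
    HasDerivAt (fun s : ℝ => trace (Z * (C + s • Y) ^ q))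
      (∑ a ∈ range q, trace (Z * (C + t • Y) ^ a * Y * (C + t • Y) ^ (q - 1 - a))) t := by
  have h : HasDerivAt (fun s : ℝ => ∑ i, ∑ j, Z i j * ((C + s • Y) ^ q) j i) _ t :=
    HasDerivAt.fun_sum fun i _ => HasDerivAt.fun_sum fun j _ =>
      (hasDerivAt_pow_apply C Y q t j i).const_mul (Z i j)
  have e : (∑ a ∈ range q, trace (Z * (C + t • Y) ^ a * Y * (C + t • Y) ^ (q - 1 - a))) =
      trace (Z * ∑ a ∈ range q, (C + t • Y) ^ a * Y * (C + t • Y) ^ (q - 1 - a)) := by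
    rw [mul_sum, trace_sum]
    simp only [Matrix.mul_assoc]
  rw [e]
  simp only [trace, Matrix.diag, Matrix.mul_apply (M := Z)]
  exact h

/-- The trace comparison behind the matrix Chernoff bound. -/
lemma trace_mul_add_pow_le {X S : Matrix ι ι ℝ} (hX : X.PosSemidef) (hS : S.PosSemidef) {L : ℝ}
    (hL : (L • (1 : Matrix ι ι ℝ) - X).PosSemidef) (q : ℕ) :
    trace (X * (S + X) ^ q) ≤ trace (X * (S + L • (1 : Matrix ι ι ℝ)) ^ q) := by
  set I := L • (1 : Matrix ι ι ℝ) with hI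
  have hder := fun t => hasDerivAt_trace_mul_pow X (S + X) (I - X) q t
  -- Powers are not operator monotone, so `X ≤ L` cannot be inserted directly. Along the segment
  -- from `S + X` to `S + L` the derivative is nonnegative exactly by the mixed trace inequality.
  have hmono : MonotoneOn (fun t : ℝ => trace (X * (S + X + t • (I - X)) ^ q)) (Set.Icc 0 1) := by
    refine monotoneOn_of_deriv_nonneg (convex_Icc 0 1)
      (fun t _ => (hder t).continuousAt.continuousWithinAt)
      (fun t _ => (hder t).differentiableAt.differentiableWithinAt) fun t ht => ?_
    rw [interior_Icc] at ht
    rw [(hder t).deriv]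
    set U := S + X + t • (I - X) with hU
    have hUp : U.PosSemidef := (hS.add hX).add (hL.smul ht.1.le)
    have hsplit : ∀ a ∈ range q, trace (X * U ^ a * (I - X) * U ^ (q - 1 - a)) =
        L * trace (X * U ^ (q - 1)) - trace (X * U ^ a * X * U ^ (q - 1 - a)) := fun a ha => by
      have ha := mem_range.1 ha
      rw [Matrix.mul_sub, Matrix.sub_mul, trace_sub, hI, Matrix.mul_smul, Matrix.mul_one,
        Matrix.smul_mul, trace_smul, smul_eq_mul, Matrix.mul_assoc, ← pow_add,
        show a + (q - 1 - a) = q - 1 by omega]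
    rw [sum_congr rfl hsplit, sum_sub_distrib, sum_const, card_range, nsmul_eq_mul]
    linarith [sum_trace_mul_pow_mul_mul_pow_le hX hUp hL q]
  have := hmono (Set.left_mem_Icc.2 zero_le_one) (Set.right_mem_Icc.2 zero_le_one) zero_le_one
  simpa [add_assoc] using this

/-- Along `S + t • X` cyclicity turns each term of the derivative into the trace of `X` against a
power of a positive semidefinite matrix. -/
lemma trace_pow_le_trace_add_pow {X S : Matrix ι ι ℝ} (hX : X.PosSemidef) (hS : S.PosSemidef)
    (q : ℕ) : trace (S ^ q) ≤ trace ((S + X) ^ q) := by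
  have hder := fun t => hasDerivAt_trace_mul_pow 1 S X q t
  have hmono : MonotoneOn (fun t : ℝ => trace (1 * (S + t • X) ^ q)) (Set.Icc 0 1) := by
    refine monotoneOn_of_deriv_nonneg (convex_Icc 0 1)
      (fun t _ => (hder t).continuousAt.continuousWithinAt)
      (fun t _ => (hder t).differentiableAt.differentiableWithinAt) fun t ht => ?_
    rw [interior_Icc] at ht
    rw [(hder t).deriv]
    have hUp : (S + t • X).PosSemidef := hS.add (hX.smul ht.1.le)
    refine sum_nonneg fun a _ => ?_
    rw [Matrix.one_mul, Matrix.mul_assoc, Matrix.trace_mul_comm, Matrix.mul_assoc, ← pow_add]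
    exact trace_mul_nonneg hX (hUp.pow _)
  have := hmono (Set.left_mem_Icc.2 zero_le_one) (Set.right_mem_Icc.2 zero_le_one) zero_le_one
  simpa using this

/-- If `q L ≤ s`, adding `L` costs a factor `(1 + 1/q) ^ q ≤ e < 3`; otherwise `s + L` is at most
`(q + 1) L`. The coefficient of `s ^ q` must not grow with `q` for the moment recursion to close. -/
lemma add_pow_le_three_mul_pow_add {s L : ℝ} (hs : 0 ≤ s) (hL : 0 ≤ L) (q : ℕ) :
    (s + L) ^ q ≤ 3 * s ^ q + ((q + 1) * L) ^ q := by
  rcases le_or_gt (q * L) s with h | h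
  · rcases Nat.eq_zero_or_pos q with rfl | hq
    · simp
    have hq' : (0 : ℝ) < q := by exact_mod_cast hq
    have h1 : s + L ≤ s * (1 + 1 / q) := by
      have : L ≤ s / q := by rw [le_div_iff₀ hq']; linarith
      calc s + L ≤ s + s / q := by linarith
        _ = _ := by ring
    have h2 : (1 + 1 / (q : ℝ)) ^ q ≤ 3 := by
      have h3 : 1 + 1 / (q : ℝ) ≤ Real.exp (1 / q) := by
        have := Real.add_one_le_exp (1 / (q : ℝ)); linarith
      calc (1 + 1 / (q : ℝ)) ^ q ≤ Real.exp (1 / q) ^ q := by gcongr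
        _ = Real.exp 1 := by rw [← Real.exp_nat_mul]; congr 1; field_simp
        _ ≤ 3 := by linarith [Real.exp_one_lt_d9]
    calc (s + L) ^ q ≤ (s * (1 + 1 / q)) ^ q := by gcongr
      _ = (1 + 1 / (q : ℝ)) ^ q * s ^ q := by rw [mul_pow, mul_comm]
      _ ≤ 3 * s ^ q := by gcongr
      _ ≤ _ := by have : 0 ≤ ((q + 1) * L) ^ q := by positivity
                  linarith
  · calc (s + L) ^ q ≤ ((q + 1) * L) ^ q := by gcongr; linarith
      _ ≤ _ := by have : 0 ≤ 3 * s ^ q := by positivity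
                  linarith

lemma trace_mul_add_smul_one_pow_le {X S : Matrix ι ι ℝ} (hX : X.PosSemidef) (hS : S.PosSemidef)
    {L : ℝ} (hL : 0 ≤ L) (q : ℕ) :
    trace (X * (S + L • (1 : Matrix ι ι ℝ)) ^ q) ≤
      3 * trace (X * S ^ q) + ((q + 1) * L) ^ q * trace X := by
  obtain ⟨V, d, hd, h1, h2, rfl⟩ := exists_diagonalization hS
  have e : trace X = ∑ i, (Vᵀ * X * V) i i * 1 := by
    rw [← trace_mul_conj_diagonal]; simp [h1]
  rw [conj_diagonal_add h1, conj_diagonal_pow h2 h1, conj_diagonal_pow h2 h1,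
    trace_mul_conj_diagonal, trace_mul_conj_diagonal, e, mul_sum, mul_sum, ← sum_add_distrib]
  refine sum_le_sum fun i _ => ?_
  have hY : 0 ≤ (Vᵀ * X * V) i i := by
    have := hX.conjTranspose_mul_mul_same V
    exact (by simpa using this : (Vᵀ * X * V).PosSemidef).diag_nonneg
  have := mul_le_mul_of_nonneg_left (add_pow_le_three_mul_pow_add (hd i) hL q) hY
  linarith

/-- The largest eigenvalue of a positive semidefinite matrix is bounded by traces of powers. -/
lemma exists_le_smul_one_and_pow_le_trace {B : Matrix ι ι ℝ} (hB : B.PosSemidef) :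
    ∃ l : ℝ, 0 ≤ l ∧ (l • (1 : Matrix ι ι ℝ) - B).PosSemidef ∧
      ∀ q : ℕ, q ≠ 0 → l ^ q ≤ trace (B ^ q) := by
  obtain ⟨V, d, hd, h1, h2, rfl⟩ := exists_diagonalization hB
  -- `l` is the largest eigenvalue, or `0` for an empty index type; there `q = 0` would fail, since
  -- `0 ^ 0 = 1` exceeds the trace of the empty matrix.
  have key : ∃ l : ℝ, 0 ≤ l ∧ (∀ i, d i ≤ l) ∧ ∀ q : ℕ, q ≠ 0 → l ^ q ≤ ∑ i, d i ^ q := by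
    rcases isEmpty_or_nonempty ι with hι | hι
    · exact ⟨0, le_rfl, fun i => (hι.false i).elim, fun q hq => by simp [hq]⟩
    · obtain ⟨i, hi⟩ := Finite.exists_max d
      exact ⟨d i, hd i, hi, fun q _ =>
        single_le_sum (f := fun i => d i ^ q) (fun j _ => pow_nonneg (hd j) q) (mem_univ i)⟩
  obtain ⟨l, hl0, hl, hlq⟩ := key
  refine ⟨l, hl0, ?_, fun q hq => ?_⟩
  · have : l • (1 : Matrix ι ι ℝ) - V * diagonal d * Vᵀ =
        V * diagonal (fun i => l - d i) * Vᴴ := by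
      have h3 : l • (1 : Matrix ι ι ℝ) = V * diagonal (fun _ => l) * Vᵀ := by
        have := conj_diagonal_add h1 (fun _ => 0) l
        simpa using this
      rw [h3, ← Matrix.sub_mul, ← Matrix.mul_sub, diagonal_sub]; simp
    rw [this]
    exact (PosSemidef.diagonal fun i => by simpa using hl i).mul_mul_conjTranspose_same V
  · have := trace_mul_conj_diagonal 1 V (fun i => d i ^ q)
    rw [conj_diagonal_pow h2 h1]
    simp only [Matrix.mul_one, h2, one_apply_eq, one_mul] at this
    rw [this]
    exact hlq q hq

end MatrixTrace

/-! ### Matrix Rosenthal and Chernoff inequalities -/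

section Chernoff

variable {κ Ω ι : Type*} [Fintype κ] [DecidableEq κ] [Fintype Ω] [Nonempty Ω]

/-- Swapping the coordinate `ω j` with a fresh `x` is an involution of the product space. This is
the form in which independence of coordinate `j` from the others is used. -/
lemma expect_expect_update (j : κ) (φ : (κ → Ω) → ℝ) :
    𝔼 ω, 𝔼 x, φ (Function.update ω j x) = 𝔼 ω, φ ω := by
  have h1 : 𝔼 p : (κ → Ω) × Ω, φ (Function.update p.1 j p.2) = 𝔼 p : (κ → Ω) × Ω, φ p.1 := by
    let e : (κ → Ω) × Ω ≃ (κ → Ω) × Ω :=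
      { toFun := fun p => (Function.update p.1 j p.2, p.1 j)
        invFun := fun p => (Function.update p.1 j p.2, p.1 j)
        left_inv := fun p => by simp
        right_inv := fun p => by simp }
    exact Fintype.expect_equiv e _ _ fun p => rfl
  rw [← univ_product_univ, expect_product, expect_product] at h1
  simpa using h1

lemma expect_apply_coord (j : κ) (g : Ω → ℝ) : 𝔼 ω : κ → Ω, g (ω j) = 𝔼 x, g x := by
  rw [← expect_expect_update j]
  simp

variable [Fintype ι] [DecidableEq ι]

/-- Matrix Chernoff/Rosenthal inequality in moment form, for a sum of independent positive
semidefinite matrices. -/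
theorem expect_trace_sum_pow_le {F : κ → Ω → Matrix ι ι ℝ} (hF : ∀ j x, (F j x).PosSemidef)
    {L : κ → Ω → ℝ} (hL0 : ∀ j x, 0 ≤ L j x)
    (hL : ∀ j x, (L j x • (1 : Matrix ι ι ℝ) - F j x).PosSemidef) {m : κ → ℝ}
    (hm : ∀ j (T : Matrix ι ι ℝ), T.PosSemidef → 𝔼 x, trace (F j x * T) ≤ m j * trace T)
    {d R : ℝ} (hd : (Fintype.card ι : ℝ) ≤ d) (hm0 : ∀ j, 0 ≤ m j) (hR : 6 * ∑ j, m j ≤ R) {p : ℕ}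
    (h : ∀ q : ℕ, q < p →
      (q + 1 : ℝ) ^ q * ∑ j, 𝔼 x, L j x ^ q * trace (F j x) ≤ d * R ^ (q + 1) / 2) :
    𝔼 ω : κ → Ω, trace ((∑ j, F j (ω j)) ^ p) ≤ d * R ^ p := by
  have hR0 : 0 ≤ R := le_trans (mul_nonneg (by norm_num) (sum_nonneg fun j _ => hm0 j)) hR
  have hd0 : 0 ≤ d := le_trans (Nat.cast_nonneg _) hd
  suffices H : ∀ q ≤ p, 𝔼 ω : κ → Ω, trace ((∑ j, F j (ω j)) ^ q) ≤ d * R ^ q from H p le_rfl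
  intro q
  induction q with
  | zero => intro _; simpa using hd
  | succ q ih =>
    intro hq
    have ih := ih (by omega)
    have hS : ∀ ω : κ → Ω, (∑ j, F j (ω j)).PosSemidef := fun ω =>
      posSemidef_sum _ fun j _ => hF j (ω j)
    have hS' : ∀ (ω : κ → Ω) j, (∑ i ∈ univ.erase j, F i (ω i)).PosSemidef := fun ω j =>
      posSemidef_sum _ fun j _ => hF j (ω j)
    have hsplit : ∀ (ω : κ → Ω) j, ∑ i, F i (ω i) = ∑ i ∈ univ.erase j, F i (ω i) + F j (ω j) :=
      fun ω j => (sum_erase_add _ _ (mem_univ j)).symm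
    -- Replacing the `j`th summand inside the power by the scalar `L j` and expanding leaves `F j`
    -- against a power of the sum of the others, which is independent of it, plus a term in `F j`
    -- alone.
    have step : ∀ j, 𝔼 ω : κ → Ω, trace (F j (ω j) * (∑ i, F i (ω i)) ^ q) ≤
        3 * (m j * (d * R ^ q)) + (q + 1 : ℝ) ^ q * 𝔼 x, L j x ^ q * trace (F j x) := by
      intro j
      calc 𝔼 ω : κ → Ω, trace (F j (ω j) * (∑ i, F i (ω i)) ^ q)
          ≤ 𝔼 ω : κ → Ω, (3 * trace (F j (ω j) * (∑ i ∈ univ.erase j, F i (ω i)) ^ q) +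
              (q + 1 : ℝ) ^ q * (L j (ω j) ^ q * trace (F j (ω j)))) := by
            refine expect_le_expect fun ω _ => ?_
            rw [hsplit ω j, ← mul_assoc, ← mul_pow]
            exact (trace_mul_add_pow_le (hF j _) (hS' ω j) (hL j _) q).trans
              (trace_mul_add_smul_one_pow_le (hF j _) (hS' ω j) (hL0 j _) q)
        _ = 3 * 𝔼 ω : κ → Ω, trace (F j (ω j) * (∑ i ∈ univ.erase j, F i (ω i)) ^ q) +
              (q + 1 : ℝ) ^ q * 𝔼 x, L j x ^ q * trace (F j x) := by
            rw [expect_add_distrib, ← mul_expect, ← mul_expect,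
              expect_apply_coord j fun x => L j x ^ q * trace (F j x)]
        _ ≤ _ := by
            gcongr
            -- With coordinate `j` resampled, `hm` averages `F j` against the fixed matrix; the
            -- missing summand is then put back, which only increases the trace.
            rw [← expect_expect_update j]
            have e : ∀ (ω : κ → Ω) x, ∑ i ∈ univ.erase j, F i (Function.update ω j x i) =
                ∑ i ∈ univ.erase j, F i (ω i) := fun ω x =>
              sum_congr rfl fun i hi => by rw [Function.update_of_ne (ne_of_mem_erase hi)]
            simp only [e, Function.update_self]
            calc _ ≤ 𝔼 ω : κ → Ω, m j * trace ((∑ i, F i (ω i)) ^ q) := by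
                  refine expect_le_expect fun ω _ => (hm j _ ((hS' ω j).pow q)).trans ?_
                  refine mul_le_mul_of_nonneg_left ?_ (hm0 j)
                  rw [hsplit ω j]
                  exact trace_pow_le_trace_add_pow (hF j _) (hS' ω j) q
              _ ≤ _ := by
                  rw [← mul_expect]
                  exact mul_le_mul_of_nonneg_left ih (hm0 j)
    calc 𝔼 ω : κ → Ω, trace ((∑ j, F j (ω j)) ^ (q + 1))
        = ∑ j, 𝔼 ω : κ → Ω, trace (F j (ω j) * (∑ i, F i (ω i)) ^ q) := by
          rw [← expect_sum_comm]
          refine expect_congr rfl fun ω _ => ?_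
          rw [pow_succ', Matrix.sum_mul, trace_sum]
      _ ≤ ∑ j, (3 * (m j * (d * R ^ q)) + (q + 1 : ℝ) ^ q * 𝔼 x, L j x ^ q * trace (F j x)) :=
          sum_le_sum fun j _ => step j
      _ = 3 * ((∑ j, m j) * (d * R ^ q)) +
            (q + 1 : ℝ) ^ q * ∑ j, 𝔼 x, L j x ^ q * trace (F j x) := by
          rw [sum_add_distrib, ← mul_sum, ← mul_sum, ← sum_mul]
      -- Half of the target pays for the mean term, by `6 * ∑ m ≤ R`, and half for the term
      -- controlled by `h`.
      _ ≤ (d * R ^ q) * (6 * ∑ j, m j) / 2 + d * R ^ (q + 1) / 2 := by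
          have := h q (by omega); linarith
      _ ≤ (d * R ^ q) * R / 2 + d * R ^ (q + 1) / 2 := by
          gcongr
      _ = d * R ^ (q + 1) := by ring

/-- The matrix Chernoff inequality with a uniform bound on the summands. -/
theorem expect_trace_sum_pow_le_of_uniform {F : κ → Ω → Matrix ι ι ℝ}
    (hF : ∀ j x, (F j x).PosSemidef) {L : ℝ} (hL0 : 0 ≤ L)
    (hL : ∀ j x, (L • (1 : Matrix ι ι ℝ) - F j x).PosSemidef) {m : κ → ℝ}
    (hm : ∀ j (T : Matrix ι ι ℝ), T.PosSemidef → 𝔼 x, trace (F j x * T) ≤ m j * trace T)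
    {d R : ℝ} (hd : (Fintype.card ι : ℝ) ≤ d) (hm0 : ∀ j, 0 ≤ m j) (hR : 6 * ∑ j, m j ≤ R) {p : ℕ}
    (hpR : p * L ≤ R) :
    𝔼 ω : κ → Ω, trace ((∑ j, F j (ω j)) ^ p) ≤ d * R ^ p := by
  refine expect_trace_sum_pow_le hF (fun _ _ => hL0) hL hm hd hm0 hR fun q hq => ?_
  have hs0 : 0 ≤ ∑ j, m j := sum_nonneg fun j _ => hm0 j
  have hR0 : 0 ≤ R := le_trans (mul_nonneg (by norm_num) hs0) hR
  have hd0 : 0 ≤ d := le_trans (Nat.cast_nonneg _) hd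
  have h1 : ∑ j, 𝔼 x, trace (F j x) ≤ (∑ j, m j) * d := by
    rw [sum_mul]
    refine sum_le_sum fun j _ => ?_
    have := hm j 1 PosSemidef.one
    simp only [Matrix.mul_one, trace_one] at this
    exact this.trans (mul_le_mul_of_nonneg_left hd (hm0 j))
  have h2 : ((q : ℝ) + 1) * L ≤ R := le_trans (by gcongr; exact_mod_cast hq) hpR
  calc (q + 1 : ℝ) ^ q * ∑ j, 𝔼 x, L ^ q * trace (F j x)
      = ((q + 1 : ℝ) * L) ^ q * ∑ j, 𝔼 x, trace (F j x) := by
        simp only [← mul_expect, ← mul_sum]; rw [mul_pow]; ring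
    _ ≤ ((q + 1 : ℝ) * L) ^ q * ((∑ j, m j) * d) := by gcongr
    _ ≤ R ^ q * ((∑ j, m j) * d) := by gcongr
    _ ≤ R ^ q * (R / 2 * d) := by gcongr; linarith
    _ = _ := by ring

end Chernoff

/-! ### Random signs and their pair products -/

section Signs

variable {n : ℕ}

/-- The sign of a bit. -/
def sgn (b : Bool) : ℝ := if b then 1 else -1

lemma sgn_mul_self (b : Bool) : sgn b * sgn b = 1 := by cases b <;> norm_num [sgn]

lemma sgn_not (b : Bool) : sgn (!b) = -sgn b := by cases b <;> norm_num [sgn]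

lemma sgn_beq (b c : Bool) : sgn (b == c) = sgn b * sgn c := by
  cases b <;> cases c <;> norm_num [sgn]

/-- The vector of pairwise products of the entries of `r`. -/
def pairProd (r : Fin n → ℝ) (e : Pairs n) : ℝ :=
  Sym2.lift ⟨fun k l => r k * r l, fun _ _ => mul_comm _ _⟩ e.1

@[simp] lemma pairProd_mk (r : Fin n → ℝ) (k l : Fin n) (h : ¬ (s(k, l) : Sym2 (Fin n)).IsDiag) :
    pairProd r ⟨s(k, l), h⟩ = r k * r l := rfl

lemma Pairs.exists_rep (e : Pairs n) :
    ∃ (k l : Fin n) (h : ¬ (s(k, l) : Sym2 (Fin n)).IsDiag), k ≠ l ∧ e = ⟨s(k, l), h⟩ := by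
  obtain ⟨e, he⟩ := e
  induction e with
  | h k l => exact ⟨k, l, he, fun h => he (by simp [h]), rfl⟩

lemma pairProd_mul (r s : Fin n → ℝ) (e : Pairs n) :
    pairProd (fun k => r k * s k) e = pairProd r e * pairProd s e := by
  obtain ⟨k, l, h, -, rfl⟩ := e.exists_rep
  simp only [pairProd_mk]; ring

lemma pairProd_congr {r s : Fin n → ℝ} {e : Pairs n} (h : ∀ k ∈ e.1, r k = s k) :
    pairProd r e = pairProd s e := by
  obtain ⟨k, l, hkl, -, rfl⟩ := e.exists_rep
  simp only [pairProd_mk]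
  rw [h k (by simp), h l (by simp)]

/-- The vector of pairwise products of a sign vector. -/
def signPair (x : Fin n → Bool) (e : Pairs n) : ℝ := pairProd (fun k => sgn (x k)) e

lemma signPair_mul_self (x : Fin n → Bool) (e : Pairs n) : signPair x e * signPair x e = 1 := by
  rw [signPair, ← pairProd_mul]
  obtain ⟨k, l, h, -, rfl⟩ := e.exists_rep
  simp [sgn_mul_self]

/-- Comparing bits multiplies signs, so multiplying by a fixed sign vector is a bijection of the
cube. -/
lemma signPair_beq (x y : Fin n → Bool) (e : Pairs n) :
    signPair (fun k => x k == y k) e = signPair x e * signPair y e := by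
  simp only [signPair, sgn_beq, pairProd_mul]

/-- Flipping bit `k` preserves the uniform average and negates `φ`. -/
lemma expect_eq_zero_of_flip (k : Fin n) {φ : (Fin n → Bool) → ℝ}
    (h : ∀ x, φ (Function.update x k (!x k)) = -φ x) : 𝔼 x, φ x = 0 := by
  let e : (Fin n → Bool) ≃ (Fin n → Bool) :=
    { toFun := fun x => Function.update x k (!x k)
      invFun := fun x => Function.update x k (!x k)
      left_inv := fun x => by simp
      right_inv := fun x => by simp }
  have : 𝔼 x, -φ x = 𝔼 x, φ x := Fintype.expect_equiv e _ _ fun x => (h x).symm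
  rw [expect_neg_distrib] at this
  linarith

lemma expect_sgn_mul_sgn (k l : Fin n) :
    𝔼 x : Fin n → Bool, sgn (x k) * sgn (x l) = if k = l then 1 else 0 := by
  split_ifs with h
  · subst h; simp [sgn_mul_self]
  · refine expect_eq_zero_of_flip k fun x => ?_
    rw [Function.update_self, Function.update_of_ne (Ne.symm h), sgn_not]; ring

lemma signPair_flip_of_mem (x : Fin n → Bool) {k : Fin n} {e : Pairs n} (h : k ∈ e.1) :
    signPair (Function.update x k (!x k)) e = -signPair x e := by
  obtain ⟨a, b, hab, hne, rfl⟩ := e.exists_rep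
  simp only [signPair, pairProd_mk]
  rcases Sym2.mem_iff.1 h with rfl | rfl
  · rw [Function.update_self, Function.update_of_ne hne.symm, sgn_not]; ring
  · rw [Function.update_self, Function.update_of_ne hne, sgn_not]; ring

lemma signPair_flip_of_notMem (x : Fin n → Bool) {k : Fin n} {e : Pairs n} (h : k ∉ e.1) :
    signPair (Function.update x k (!x k)) e = signPair x e :=
  pairProd_congr fun l hl => by rw [Function.update_of_ne (by rintro rfl; exact h hl)]

lemma expect_signPair_mul_signPair (e f : Pairs n) :
    𝔼 x, signPair x e * signPair x f = if e = f then 1 else 0 := by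
  split_ifs with h
  · subst h; simp [signPair_mul_self]
  · obtain ⟨k, hke, hkf⟩ : ∃ k, k ∈ e.1 ∧ k ∉ f.1 := by
      by_contra! hc
      obtain ⟨a, b, hab, hne, rfl⟩ := e.exists_rep
      exact h (Subtype.ext ((Sym2.mem_and_mem_iff hne).1 ⟨hc a (by simp), hc b (by simp)⟩).symm)
    refine expect_eq_zero_of_flip k fun x => ?_
    rw [signPair_flip_of_mem x hke, signPair_flip_of_notMem x hkf]; ring

lemma card_pairs_le (n : ℕ) : (Fintype.card (Pairs n) : ℝ) ≤ n ^ 2 / 2 := by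
  have : Fintype.card (Pairs n) = n.choose 2 := by
    rw [Sym2.card_subtype_not_diag, Fintype.card_fin]
  rw [this, Nat.cast_choose_two]
  have : (0 : ℝ) ≤ n := Nat.cast_nonneg n
  nlinarith

end Signs

/-! ### Rank one matrices and sums of isotropic sign vectors -/

section RankOne

variable {ι : Type*} [Fintype ι]

lemma posSemidef_vecMulVec (v : ι → ℝ) : (vecMulVec v v).PosSemidef := by
  simpa using posSemidef_vecMulVec_self_star v

lemma trace_vecMulVec_mul (v : ι → ℝ) (T : Matrix ι ι ℝ) :
    trace (vecMulVec v v * T) = ∑ i, ∑ j, v i * v j * T j i := by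
  simp [trace, Matrix.mul_apply, vecMulVec_apply]

lemma trace_vecMulVec_self (v : ι → ℝ) : trace (vecMulVec v v) = ∑ i, v i ^ 2 := by
  simp [trace, vecMulVec_apply, sq]

lemma dotProduct_vecMulVec_mulVec (v u : ι → ℝ) :
    u ⬝ᵥ (vecMulVec v v *ᵥ u) = (∑ i, u i * v i) ^ 2 := by
  rw [vecMulVec_mulVec, sq, op_smul_eq_smul, dotProduct_smul, smul_eq_mul]
  simp only [dotProduct]
  congr 1
  exact sum_congr rfl fun i _ => mul_comm _ _

variable [DecidableEq ι]

lemma posSemidef_smul_one_sub_iff {A : Matrix ι ι ℝ} (hA : A.IsHermitian) {l : ℝ} :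
    (l • (1 : Matrix ι ι ℝ) - A).PosSemidef ↔
      ∀ u : ι → ℝ, u ⬝ᵥ (A *ᵥ u) ≤ l * ∑ i, u i ^ 2 := by
  have e : ∀ u : ι → ℝ, u ⬝ᵥ ((l • (1 : Matrix ι ι ℝ) - A) *ᵥ u) =
      l * ∑ i, u i ^ 2 - u ⬝ᵥ (A *ᵥ u) := fun u => by
    rw [Matrix.sub_mulVec, dotProduct_sub, Matrix.smul_mulVec, one_mulVec, dotProduct_smul]
    simp [dotProduct, sq]
  have hH : (l • (1 : Matrix ι ι ℝ) - A).IsHermitian := by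
    refine IsHermitian.sub ?_ hA
    simp [IsHermitian]
  rw [posSemidef_iff_dotProduct_mulVec]
  constructor
  · intro h u
    have := h.2 u
    rw [star_trivial, e] at this
    linarith
  · intro h
    refine ⟨hH, fun u => ?_⟩
    rw [star_trivial, e]
    linarith [h u]

lemma posSemidef_smul_one_sub_vecMulVec {v : ι → ℝ} {l : ℝ} (h : ∑ i, v i ^ 2 ≤ l) :
    (l • (1 : Matrix ι ι ℝ) - vecMulVec v v).PosSemidef := by
  rw [posSemidef_smul_one_sub_iff (posSemidef_vecMulVec v).1]
  intro u
  rw [dotProduct_vecMulVec_mulVec]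
  calc _ ≤ (∑ i, u i ^ 2) * ∑ i, v i ^ 2 := sum_mul_sq_le_sq_mul_sq _ _ _
    _ ≤ (∑ i, u i ^ 2) * l := by gcongr
    _ = _ := mul_comm _ _

/-- Trace moments of a sum of independent isotropic vectors with entries `±1`. -/
lemma expect_trace_sum_vecMulVec_pow_le {κ Ω : Type*} [Fintype κ] [DecidableEq κ] [Fintype Ω]
    [Nonempty Ω] {v : Ω → ι → ℝ} (hv : ∀ x i, v x i * v x i = 1)
    (hiso : ∀ i j, 𝔼 x, v x i * v x j = if i = j then 1 else 0) {R : ℝ} {p : ℕ}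
    (h1 : 6 * (Fintype.card κ : ℝ) ≤ R) (h2 : p * (Fintype.card ι : ℝ) ≤ R) :
    𝔼 ω : κ → Ω, trace ((∑ j, vecMulVec (v (ω j)) (v (ω j))) ^ p) ≤ Fintype.card ι * R ^ p := by
  -- Each summand has mean the identity, whence `m = 1`, and norm equal to the dimension, whence
  -- `L`.
  refine expect_trace_sum_pow_le_of_uniform (F := fun _ x => vecMulVec (v x) (v x))
    (fun _ _ => posSemidef_vecMulVec _) (L := Fintype.card ι) (Nat.cast_nonneg _)
    (fun _ x => posSemidef_smul_one_sub_vecMulVec (by simp [sq, hv])) (m := fun _ => 1)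
    (fun _ T _ => ?_) le_rfl (fun _ => zero_le_one) (by simpa using h1) h2
  simp only [trace_vecMulVec_mul, expect_sum_comm, ← expect_mul, hiso]
  simp [trace]

/-- `V Vᵀ` and `Vᵀ V` share their nonzero spectrum; `q = 0` is excluded because it would compare the
two dimensions. -/
lemma trace_mul_transpose_pow {κ : Type*} [Fintype κ] [DecidableEq κ] (V : Matrix κ ι ℝ) {q : ℕ}
    (hq : q ≠ 0) : trace ((V * Vᵀ) ^ q) = trace ((Vᵀ * V) ^ q) := by
  have h : ∀ q, V * (Vᵀ * V) ^ q = (V * Vᵀ) ^ q * V := fun q => by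
    induction q with
    | zero => simp
    | succ q ih => rw [pow_succ, ← Matrix.mul_assoc, ih, pow_succ]; simp only [Matrix.mul_assoc]
  obtain ⟨q, rfl⟩ := Nat.exists_eq_succ_of_ne_zero hq
  rw [Nat.succ_eq_add_one, pow_succ, ← Matrix.mul_assoc, ← h, Matrix.trace_mul_comm,
    ← Matrix.mul_assoc, ← pow_succ']

end RankOne

/-! ### Moments of sums of signs -/

section Scalar

variable {n : ℕ}

lemma expect_exp_sum_sgn (K : Finset (Fin n)) (t : ℝ) :
    𝔼 x : Fin n → Bool, Real.exp (t * ∑ k ∈ K, sgn (x k)) = Real.cosh t ^ #K := by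
  have h1 : ∀ x : Fin n → Bool, Real.exp (t * ∑ k ∈ K, sgn (x k)) =
      ∏ k, if k ∈ K then Real.exp (t * sgn (x k)) else 1 := fun x => by
    rw [mul_sum, Real.exp_sum, prod_ite_mem, univ_inter]
  simp only [h1]
  rw [Fintype.expect_eq_sum_div_card]
  have h2 := Fintype.prod_sum (fun (k : Fin n) (b : Bool) =>
    if k ∈ K then Real.exp (t * sgn b) else (1 : ℝ))
  rw [← h2]
  have h3 : ∀ k, ∑ b : Bool, (if k ∈ K then Real.exp (t * sgn b) else (1 : ℝ)) =
      2 * if k ∈ K then Real.cosh t else 1 := fun k => by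
    rw [Fintype.sum_bool]
    split_ifs
    · simp only [sgn, if_true, Bool.false_eq_true, if_false, Real.cosh_eq]; ring_nf
    · norm_num
  simp only [h3, prod_mul_distrib, prod_ite_mem, univ_inter, prod_const, card_univ,
    Fintype.card_fin, Fintype.card_fun, Fintype.card_bool]
  field_simp
  push_cast; ring

/-- The exponential moment dominates `(t y) ^ (2p) / (2p)!`, and `cosh t ≤ exp (t² / 2)` bounds it.
-/
lemma expect_sum_sgn_pow_le (K : Finset (Fin n)) {p : ℕ} (hp : p ≠ 0) (hn : 1 ≤ n) :
    𝔼 x : Fin n → Bool, (∑ k ∈ K, sgn (x k)) ^ (2 * p) ≤ 2 * (6 * p * n : ℝ) ^ p := by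
  have hn' : (0 : ℝ) < n := by exact_mod_cast hn
  have hp' : (0 : ℝ) < p := by exact_mod_cast Nat.pos_of_ne_zero hp
  -- Chosen so that `n t² / 2 = p`, making the exponential moment at most `exp p ≤ 3 ^ p`.
  set t : ℝ := Real.sqrt (2 * p / n) with ht
  have ht2 : t ^ 2 = 2 * p / n := Real.sq_sqrt (by positivity)
  have hK : (#K : ℝ) ≤ n := by exact_mod_cast (card_le_univ K).trans (by simp)
  have hcosh : Real.cosh t ^ #K ≤ Real.exp p := by
    calc Real.cosh t ^ #K ≤ Real.exp (t ^ 2 / 2) ^ #K := by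
          gcongr
          exact Real.cosh_le_exp_half_sq t
      _ = Real.exp (#K * (t ^ 2 / 2)) := by rw [← Real.exp_nat_mul]
      _ ≤ Real.exp p := by
          rw [Real.exp_le_exp, ht2]
          calc _ ≤ (n : ℝ) * (2 * p / n / 2) := by gcongr
            _ = p := by field_simp
  have key : ∀ y : ℝ, t ^ (2 * p) * y ^ (2 * p) ≤
      (2 * p).factorial * (Real.exp (t * y) + Real.exp (-t * y)) := fun y => by
    have h1 := Real.pow_div_factorial_le_exp |t * y| (abs_nonneg _) (2 * p)
    rw [div_le_iff₀ (by positivity), Even.pow_abs (even_two_mul p), mul_pow] at h1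
    have h2 : Real.exp |t * y| ≤ Real.exp (t * y) + Real.exp (-t * y) := by
      rcases abs_cases (t * y) with ⟨h, -⟩ | ⟨h, -⟩ <;> rw [h]
      · linarith [Real.exp_pos (-t * y)]
      · rw [neg_mul]; linarith [Real.exp_pos (t * y)]
    calc _ ≤ _ := h1
      _ ≤ (Real.exp (t * y) + Real.exp (-t * y)) * (2 * p).factorial := by gcongr
      _ = _ := mul_comm _ _
  have h3 : t ^ (2 * p) * 𝔼 x : Fin n → Bool, (∑ k ∈ K, sgn (x k)) ^ (2 * p) ≤
      (2 * p).factorial * (2 * Real.exp p) := by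
    rw [mul_expect]
    calc _ ≤ 𝔼 x : Fin n → Bool, ((2 * p).factorial : ℝ) *
          (Real.exp (t * ∑ k ∈ K, sgn (x k)) + Real.exp (-t * ∑ k ∈ K, sgn (x k))) :=
          expect_le_expect fun x _ => key _
      _ = (2 * p).factorial * (2 * Real.cosh t ^ #K) := by
          rw [← mul_expect, expect_add_distrib, expect_exp_sum_sgn, expect_exp_sum_sgn,
            Real.cosh_neg]; ring
      _ ≤ _ := by gcongr
  have h4 : ((2 * p).factorial : ℝ) ≤ (2 * p : ℝ) ^ (2 * p) := by
    exact_mod_cast Nat.factorial_le_pow (2 * p)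
  have h5 : Real.exp p ≤ 3 ^ p := by
    rw [← mul_one (p : ℝ), Real.exp_nat_mul]
    gcongr
    linarith [Real.exp_one_lt_d9]
  have h6 : t ^ (2 * p) = (2 * p / n) ^ p := by rw [pow_mul, ht2]
  rw [h6] at h3
  have h7 : (0 : ℝ) < (2 * p / n) ^ p := by positivity
  rw [← mul_le_mul_iff_right₀ h7]
  calc _ ≤ _ := h3
    _ ≤ (2 * p : ℝ) ^ (2 * p) * (2 * 3 ^ p) := by gcongr
    _ = 2 * ((2 * p / n) * (6 * p * n)) ^ p := by
        rw [show (2 * p / n : ℝ) * (6 * p * n) = (2 * p) ^ 2 * 3 by field_simp; ring,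
          mul_pow ((2 * p : ℝ) ^ 2),
          ← pow_mul]
        ring
    _ = _ := by rw [mul_pow]; ring

end Scalar

/-! ### Sums over unordered pairs -/

section PairSums

variable {n : ℕ}

lemma sum_pairs_eq (f : Sym2 (Fin n) → ℝ) :
    2 * ∑ e : Pairs n, f e.1 = ∑ k, ∑ l, if k = l then 0 else f s(k, l) := by
  have h1 : ∑ e : Pairs n, f e.1 = ∑ i ∈ (univ : Finset (Fin n)).sym2 with ¬ i.IsDiag, f i := by
    rw [sym2_univ]
    exact (sum_subtype _ (by simp) f).symm
  have h2 : ∑ e : Pairs n, f e.1 = ∑ k, ∑ l, if k < l then f s(k, l) else 0 := by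
    rw [h1, sum_sym2_filter_not_isDiag, ← sum_product', univ_product_univ, ← sum_filter]
    refine sum_congr ?_ fun _ _ => rfl
    ext ⟨a, b⟩
    simp only [mem_filter, mem_offDiag, mem_univ, true_and]
    exact ⟨fun h => h.2, fun h => ⟨h.ne, h⟩⟩
  have h3 : ∑ e : Pairs n, f e.1 = ∑ k, ∑ l, if l < k then f s(k, l) else 0 := by
    rw [h2, sum_comm]
    exact sum_congr rfl fun k _ => sum_congr rfl fun l _ => by rw [Sym2.eq_swap]
  rw [two_mul]
  nth_rw 1 [h2]
  rw [h3, ← sum_add_distrib]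
  refine sum_congr rfl fun k _ => ?_
  rw [← sum_add_distrib]
  refine sum_congr rfl fun l _ => ?_
  rcases lt_trichotomy k l with h | h | h
  · simp [h, h.ne, h.le]
  · simp [h]
  · simp [h, h.ne', h.le]

lemma two_mul_sum_pairProd (r : Fin n → ℝ) :
    2 * ∑ e, pairProd r e = (∑ k, r k) ^ 2 - ∑ k, r k ^ 2 := by
  have := sum_pairs_eq (n := n) (Sym2.lift ⟨fun k l => r k * r l, fun _ _ => mul_comm _ _⟩)
  simp only [pairProd]
  rw [this]
  have h1 : ∀ k, (∑ l, if k = l then 0 else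
      Sym2.lift ⟨fun k l => r k * r l, fun _ _ => mul_comm _ _⟩ s(k, l)) =
      r k * ∑ l, r l - r k ^ 2 := fun k => by
    rw [mul_sum]
    have : ∀ l, (if k = l then 0 else
        Sym2.lift ⟨fun k l => r k * r l, fun _ _ => mul_comm _ _⟩ s(k, l)) =
        r k * r l - if k = l then r k ^ 2 else 0 := fun l => by
      split_ifs with h
      · subst h; ring
      · simp
    simp only [this, sum_sub_distrib, sum_ite_eq, mem_univ, if_true]
  simp only [h1, sum_sub_distrib, ← sum_mul]
  ring

end PairSums

lemma add_pow_le_two_pow_mul {a b : ℝ} (ha : 0 ≤ a) (hb : 0 ≤ b) (p : ℕ) :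
    (a + b) ^ p ≤ 2 ^ p * (a ^ p + b ^ p) := by
  refine (add_pow_le ha hb p).trans ?_
  gcongr
  · norm_num
  · omega

/-! ### Trace moments for independent sign matrices -/

section Moments

variable {n : ℕ}

/-- `∑ i, r i (r i)ᵀ` for the sign vectors `r i`. -/
def rowGram (ε : Fin n → Fin n → Bool) : Matrix (Fin n) (Fin n) ℝ :=
  ∑ i, vecMulVec (fun k => sgn (ε i k)) (fun k => sgn (ε i k))

/-- `∑ i, a i (a i)ᵀ` for the pair vectors `a i` of the sign vectors. -/
def pairGram (ε : Fin n → Fin n → Bool) : Matrix (Pairs n) (Pairs n) ℝ :=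
  ∑ i, vecMulVec (signPair (ε i)) (signPair (ε i))

/-- The sum over all pairs `(i, j)` of the rank one matrices of the vectors `a i ∘ a' j`. -/
def prodGram (ε ε' : Fin n → Fin n → Bool) : Matrix (Pairs n) (Pairs n) ℝ :=
  ∑ j, ∑ i, vecMulVec (fun e => signPair (ε i) e * signPair (ε' j) e)
    (fun e => signPair (ε i) e * signPair (ε' j) e)

/-- The inner products of the pair vector of `x` with the `a' j`, over pairs inside `K`. -/
def crossVec (K : Finset (Fin n)) (ε' : Fin n → Fin n → Bool) (x : Fin n → Bool) (j : Fin n) : ℝ :=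
  ∑ e, pairProd (fun k => if k ∈ K then 1 else 0) e * signPair x e * signPair (ε' j) e

/-- `∑ i, g i (g i)ᵀ` for the vectors `g i = crossVec K ε' (ε i)`. -/
def crossGram (K : Finset (Fin n)) (ε ε' : Fin n → Fin n → Bool) : Matrix (Fin n) (Fin n) ℝ :=
  ∑ i, vecMulVec (crossVec K ε' (ε i)) (crossVec K ε' (ε i))

lemma posSemidef_rowGram (ε : Fin n → Fin n → Bool) : (rowGram ε).PosSemidef :=
  posSemidef_sum _ fun _ _ => posSemidef_vecMulVec _

lemma posSemidef_pairGram (ε : Fin n → Fin n → Bool) : (pairGram ε).PosSemidef :=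
  posSemidef_sum _ fun _ _ => posSemidef_vecMulVec _

lemma posSemidef_prodGram (ε ε' : Fin n → Fin n → Bool) : (prodGram ε ε').PosSemidef :=
  posSemidef_sum _ fun _ _ => posSemidef_sum _ fun _ _ => posSemidef_vecMulVec _

lemma posSemidef_crossGram (K : Finset (Fin n)) (ε ε' : Fin n → Fin n → Bool) :
    (crossGram K ε ε').PosSemidef :=
  posSemidef_sum _ fun _ _ => posSemidef_vecMulVec _

lemma expect_trace_rowGram_pow_le {p : ℕ} (hp : 1 ≤ p) :
    𝔼 ε : Fin n → Fin n → Bool, trace (rowGram ε ^ p) ≤ n * (6 * p * n : ℝ) ^ p := by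
  have hp' : (1 : ℝ) ≤ p := by exact_mod_cast hp
  have hn : (0 : ℝ) ≤ n := Nat.cast_nonneg n
  have := expect_trace_sum_vecMulVec_pow_le (κ := Fin n) (ι := Fin n) (Ω := Fin n → Bool)
    (v := fun x k => sgn (x k)) (fun x k => sgn_mul_self _) (fun k l => expect_sgn_mul_sgn k l)
    (R := 6 * p * n) (p := p) (by simp only [Fintype.card_fin]; nlinarith)
    (by simp only [Fintype.card_fin]; nlinarith [mul_nonneg (zero_le_one.trans hp') hn])
  rw [Fintype.card_fin] at this
  exact this

lemma expect_trace_pairGram_pow_le {p : ℕ} (hp : 1 ≤ p) (hn : 1 ≤ n) :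
    𝔼 ε : Fin n → Fin n → Bool, trace (pairGram ε ^ p) ≤ n ^ 2 * (6 * p * n ^ 2 : ℝ) ^ p := by
  have hp' : (1 : ℝ) ≤ p := by exact_mod_cast hp
  have hn' : (1 : ℝ) ≤ n := by exact_mod_cast hn
  have hc := card_pairs_le n
  have h1 : (n : ℝ) ≤ p * n ^ 2 := by nlinarith [mul_le_mul hp' hn' zero_le_one (by linarith)]
  have h2 : (Fintype.card (Pairs n) : ℝ) ≤ n ^ 2 := by nlinarith
  have := expect_trace_sum_vecMulVec_pow_le (κ := Fin n) (ι := Pairs n) (Ω := Fin n → Bool)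
    (v := signPair) signPair_mul_self expect_signPair_mul_signPair
    (R := 6 * p * n ^ 2) (p := p) (by simp only [Fintype.card_fin]; nlinarith)
    (by nlinarith [mul_le_mul_of_nonneg_left h2 (zero_le_one.trans hp')])
  exact this.trans (by gcongr)

/-- For fixed `ε` the inner sum belonging to row `x` of `ε'` is `pairGram ε` conjugated by the
diagonal of signs `signPair x`. Its norm is that of `pairGram ε`, and its mean over `x` is the
diagonal of `pairGram ε`, namely `n` times the identity. The matrix Chernoff bound over `ε'` then
reduces to the moments of `pairGram`. -/
lemma expect_trace_prodGram_pow_le {p : ℕ} (hp : 1 ≤ p) (hn : 1 ≤ n) :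
    𝔼 ε : Fin n → Fin n → Bool, 𝔼 ε' : Fin n → Fin n → Bool, trace (prodGram ε ε' ^ p) ≤
      2 * n ^ 4 * (12 * p ^ 2 * n ^ 2 : ℝ) ^ p := by
  have hp' : (1 : ℝ) ≤ p := by exact_mod_cast hp
  have hn' : (1 : ℝ) ≤ n := by exact_mod_cast hn
  choose l hl0 hl hlq using fun ε : Fin n → Fin n → Bool =>
    exists_le_smul_one_and_pow_le_trace (posSemidef_pairGram ε)
  have h1 : ∀ ε : Fin n → Fin n → Bool,
      𝔼 ε' : Fin n → Fin n → Bool, trace (prodGram ε ε' ^ p) ≤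
        n ^ 2 * (6 * n ^ 2 + p * l ε) ^ p := by
    intro ε
    set F : Fin n → (Fin n → Bool) → Matrix (Pairs n) (Pairs n) ℝ := fun _ x =>
      ∑ i, vecMulVec (fun e => signPair (ε i) e * signPair x e)
        (fun e => signPair (ε i) e * signPair x e) with hF
    have hent : ∀ j x e f, F j x e f = pairGram ε e f * (signPair x e * signPair x f) := by
      intro j x e f
      simp only [hF, pairGram, Matrix.sum_apply, vecMulVec_apply, sum_mul]
      exact sum_congr rfl fun i _ => by ring
    have hps : ∀ j x, (F j x).PosSemidef := fun j x =>
      posSemidef_sum _ fun _ _ => posSemidef_vecMulVec _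
    refine expect_trace_sum_pow_le_of_uniform (F := F) hps (hl0 ε) (fun j x => ?_)
      (m := fun _ => n) (fun j T _ => ?_) ?_ (fun _ => Nat.cast_nonneg n) ?_ ?_
    · have h2 : l ε • (1 : Matrix (Pairs n) (Pairs n) ℝ) - F j x =
          diagonal (signPair x) * (l ε • (1 : Matrix (Pairs n) (Pairs n) ℝ) - pairGram ε) *
            (diagonal (signPair x))ᴴ := by
        ext e f
        rw [diagonal_conjTranspose, mul_diagonal, diagonal_mul, Matrix.sub_apply, Matrix.sub_apply,
          hent j x]
        rcases eq_or_ne e f with rfl | hef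
        · simp only [Matrix.smul_apply, one_apply_eq, star_trivial, smul_eq_mul]
          linear_combination -(l ε) * signPair_mul_self x e
        · simp only [Matrix.smul_apply, one_apply_ne hef, star_trivial, smul_eq_mul]
          ring
      rw [h2]
      exact (hl ε).mul_mul_conjTranspose_same _
    · have h3 : ∀ x, trace (F j x * T) =
          ∑ e, ∑ f, pairGram ε e f * T f e * (signPair x e * signPair x f) := fun x => by
        simp only [trace, Matrix.diag, Matrix.mul_apply, hent]
        exact sum_congr rfl fun e _ => sum_congr rfl fun f _ => by ring
      have h4 : ∀ e, pairGram ε e e = n := fun e => by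
        simp [pairGram, Matrix.sum_apply, vecMulVec_apply, signPair_mul_self]
      simp only [h3, expect_sum_comm, ← mul_expect, expect_signPair_mul_signPair]
      simp [h4, trace, mul_sum]
    · have := card_pairs_le n
      nlinarith
    · simp only [sum_const, card_univ, Fintype.card_fin, nsmul_eq_mul]
      have := mul_nonneg (zero_le_one.trans hp') (hl0 ε)
      nlinarith
    · nlinarith
  calc _ ≤ 𝔼 ε : Fin n → Fin n → Bool,
        (n : ℝ) ^ 2 * (2 ^ p * ((6 * n ^ 2) ^ p + p ^ p * trace (pairGram ε ^ p))) := by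
        refine expect_le_expect fun ε _ => (h1 ε).trans ?_
        gcongr
        refine (add_pow_le_two_pow_mul (by positivity)
          (mul_nonneg (by positivity) (hl0 ε)) p).trans ?_
        rw [mul_pow (p : ℝ)]
        gcongr
        exact hlq ε p (by omega)
    _ = (n : ℝ) ^ 2 * (2 ^ p * ((6 * n ^ 2) ^ p +
          p ^ p * 𝔼 ε : Fin n → Fin n → Bool, trace (pairGram ε ^ p))) := by
        simp only [← mul_expect, expect_add_distrib, Fintype.expect_const]
    _ ≤ (n : ℝ) ^ 2 * (2 ^ p * ((6 * n ^ 2) ^ p + p ^ p * (n ^ 2 * (6 * p * n ^ 2 : ℝ) ^ p))) := by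
        gcongr
        exact expect_trace_pairGram_pow_le hp hn
    _ ≤ (n : ℝ) ^ 2 * (2 ^ p * (n ^ 2 * (6 * p ^ 2 * n ^ 2) ^ p +
          n ^ 2 * (6 * p ^ 2 * n ^ 2 : ℝ) ^ p)) := by
        have e : (p : ℝ) ^ p * (n ^ 2 * (6 * p * n ^ 2 : ℝ) ^ p) =
            n ^ 2 * (6 * p ^ 2 * n ^ 2 : ℝ) ^ p := by
          rw [mul_left_comm, ← mul_pow]; congr 2; ring
        rw [e]
        gcongr
        have h5 : (6 * n ^ 2 : ℝ) ^ p ≤ (6 * p ^ 2 * n ^ 2) ^ p := by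
          gcongr
          nlinarith [one_le_pow₀ hp' (n := 2)]
        have h6 : (1 : ℝ) ≤ n ^ 2 := one_le_pow₀ hn'
        nlinarith [pow_nonneg (by positivity : (0 : ℝ) ≤ 6 * p ^ 2 * n ^ 2) p]
    _ = _ := by
        rw [show (12 * p ^ 2 * n ^ 2 : ℝ) = 2 * (6 * p ^ 2 * n ^ 2) by ring,
          mul_pow (2 : ℝ) (6 * p ^ 2 * n ^ 2)]
        ring

/-- The product of two pair vectors is the pair vector of the product signs, so the sum over pairs
in `K` is a square of a linear sum minus its diagonal. This makes it a one-dimensional moment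
problem. -/
lemma crossVec_eq (K : Finset (Fin n)) (ε' : Fin n → Fin n → Bool) (x : Fin n → Bool) (j : Fin n) :
    crossVec K ε' x j = ((∑ k ∈ K, sgn (x k == ε' j k)) ^ 2 - #K) / 2 := by
  have h := two_mul_sum_pairProd (n := n) fun k => (if k ∈ K then 1 else 0) * sgn (x k == ε' j k)
  have h1 : ∀ k, (((if k ∈ K then 1 else 0) * sgn (x k == ε' j k)) ^ 2 : ℝ) =
      if k ∈ K then 1 else 0 := fun k => by
    split_ifs <;> simp [sq, sgn_mul_self]
  have h2 : ∑ k, (if k ∈ K then 1 else 0) * sgn (x k == ε' j k) =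
      ∑ k ∈ K, sgn (x k == ε' j k) := by
    simp [ite_mul, sum_ite_mem]
  have h3 : ∀ e, pairProd (fun k => (if k ∈ K then 1 else 0) * sgn (x k == ε' j k)) e =
      pairProd (fun k => if k ∈ K then 1 else 0) e * signPair x e * signPair (ε' j) e := fun e => by
    rw [pairProd_mul, mul_assoc, ← signPair_beq]; rfl
  simp only [h1, h2, h3, sum_ite_mem, univ_inter, sum_const, nsmul_eq_mul, mul_one] at h
  rw [crossVec]
  linarith

lemma expect_crossVec_pow_le (K : Finset (Fin n)) (ε' : Fin n → Fin n → Bool) (j : Fin n) {t : ℕ}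
    (ht : 1 ≤ t) (hn : 1 ≤ n) :
    𝔼 x, (crossVec K ε' x j ^ 2) ^ t ≤ 3 * (12 * t * n : ℝ) ^ (2 * t) := by
  have hn' : (1 : ℝ) ≤ n := by exact_mod_cast hn
  have ht' : (1 : ℝ) ≤ t := by exact_mod_cast ht
  have hK : (#K : ℝ) ≤ n := by exact_mod_cast (card_le_univ K).trans (by simp)
  have hK0 : (0 : ℝ) ≤ #K := Nat.cast_nonneg _
  have h1 : ∀ x, (crossVec K ε' x j ^ 2) ^ t ≤
      (∑ k ∈ K, sgn (x k == ε' j k)) ^ (2 * (2 * t)) + (n : ℝ) ^ (2 * t) := fun x => by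
    rw [crossVec_eq]
    set s := ∑ k ∈ K, sgn (x k == ε' j k)
    have h2 : ((s ^ 2 - #K) / 2) ^ 2 ≤ (s ^ 4 + n ^ 2) / 2 := by
      have : (0 : ℝ) ≤ s ^ 2 * #K := by positivity
      have : (#K : ℝ) ^ 2 ≤ n ^ 2 := by gcongr
      nlinarith [sq_nonneg (s ^ 2), sq_nonneg (#K : ℝ)]
    calc _ ≤ ((s ^ 4 + n ^ 2) / 2) ^ t := by gcongr
      _ = (s ^ 4 + n ^ 2) ^ t / 2 ^ t := div_pow _ _ _
      _ ≤ (2 ^ t * ((s ^ 4) ^ t + (n ^ 2) ^ t)) / 2 ^ t := by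
          gcongr
          exact add_pow_le_two_pow_mul (by positivity) (by positivity) t
      _ = (s ^ 4) ^ t + (n ^ 2) ^ t := by field_simp
      _ = _ := by rw [← pow_mul, ← pow_mul]; congr 2; ring
  have h3 : 𝔼 x : Fin n → Bool, (∑ k ∈ K, sgn (x k == ε' j k)) ^ (2 * (2 * t)) =
      𝔼 x : Fin n → Bool, (∑ k ∈ K, sgn (x k)) ^ (2 * (2 * t)) := by
    let e : (Fin n → Bool) ≃ (Fin n → Bool) :=
      { toFun := fun x k => x k == ε' j k
        invFun := fun x k => x k == ε' j k
        left_inv := fun x => by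
          funext k; show ((x k == ε' j k) == ε' j k) = x k; cases x k <;> cases ε' j k <;> rfl
        right_inv := fun x => by
          funext k; show ((x k == ε' j k) == ε' j k) = x k; cases x k <;> cases ε' j k <;> rfl }
    exact Fintype.expect_equiv e _ _ fun x => rfl
  calc _ ≤ 𝔼 x : Fin n → Bool,
        ((∑ k ∈ K, sgn (x k == ε' j k)) ^ (2 * (2 * t)) + (n : ℝ) ^ (2 * t)) :=
        expect_le_expect fun x _ => h1 x
    _ ≤ 2 * (6 * (2 * t : ℕ) * n : ℝ) ^ (2 * t) + (n : ℝ) ^ (2 * t) := by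
        rw [expect_add_distrib, h3, Fintype.expect_const]
        gcongr
        exact expect_sum_sgn_pow_le K (by omega) hn
    _ ≤ 2 * (12 * t * n : ℝ) ^ (2 * t) + (12 * t * n : ℝ) ^ (2 * t) := by
        gcongr ?_ + ?_
        · push_cast
          gcongr 2 * ?_ ^ (2 * t)
          linarith
        · gcongr
          nlinarith
    _ = _ := by ring

/-- With `ε'` fixed, the vector attached to `x` is a linear image of the isotropic `signPair x`, so
its covariance is at most `V Vᵀ`, where `V` has rows `signPair (ε' j)`. The nonzero spectrum of `V
Vᵀ` is that of `pairGram ε'`. -/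
lemma expect_trace_crossGram_pow_le (K : Finset (Fin n)) {p : ℕ} (hp : 1 ≤ p) (hn : 1 ≤ n) :
    𝔼 ε : Fin n → Fin n → Bool, 𝔼 ε' : Fin n → Fin n → Bool, trace (crossGram K ε ε' ^ p) ≤
      2 * n ^ 3 * (2000 * p ^ 3 * n ^ 3 : ℝ) ^ p := by
  have hp' : (1 : ℝ) ≤ p := by exact_mod_cast hp
  have hn' : (1 : ℝ) ≤ n := by exact_mod_cast hn
  set V : (Fin n → Fin n → Bool) → Matrix (Fin n) (Pairs n) ℝ := fun ε' =>
    Matrix.of fun j e => signPair (ε' j) e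
    with hV
  have hVV : ∀ ε', pairGram ε' = (V ε')ᵀ * V ε' := fun ε' => by
    ext e f
    simp [pairGram, hV, Matrix.sum_apply, vecMulVec_apply, Matrix.mul_apply]
  have hpos : ∀ ε', (V ε' * (V ε')ᵀ).PosSemidef := fun ε' => by
    simpa using posSemidef_self_mul_conjTranspose (V ε')
  choose l hl0 hl hlq using fun ε' => exists_le_smul_one_and_pow_le_trace (hpos ε')
  have h1 : ∀ ε' : Fin n → Fin n → Bool,
      𝔼 ε : Fin n → Fin n → Bool, trace (crossGram K ε ε' ^ p) ≤
        n * (1000 * p ^ 3 * n ^ 3 + 6 * n * l ε') ^ p := by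
    intro ε'
    have hR : 0 ≤ 6 * (n : ℝ) * l ε' := mul_nonneg (by positivity) (hl0 ε')
    refine expect_trace_sum_pow_le
      (F := fun _ x => vecMulVec (crossVec K ε' x) (crossVec K ε' x))
      -- The squared norm of the vector is typically much smaller than its maximum, so `L` depends
      -- on `x` and only its moments enter; this is why the nonuniform inequality is needed.
      (fun _ _ => posSemidef_vecMulVec _) (L := fun _ x => ∑ j, crossVec K ε' x j ^ 2)
      (fun _ x => sum_nonneg fun j _ => sq_nonneg _)
      (fun _ x => posSemidef_smul_one_sub_vecMulVec le_rfl) (m := fun _ => l ε')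
      (fun j T hT => ?_) (by simp) (fun _ => hl0 ε') ?_ (fun q hq => ?_)
    · have e1 : ∀ i j, 𝔼 x, crossVec K ε' x i * crossVec K ε' x j =
          ∑ e, pairProd (fun k => if k ∈ K then 1 else 0) e ^ 2 *
            (signPair (ε' i) e * signPair (ε' j) e) := fun i j => by
        have : ∀ x, crossVec K ε' x i * crossVec K ε' x j = ∑ e, ∑ f,
            (pairProd (fun k => if k ∈ K then 1 else 0) e *
              pairProd (fun k => if k ∈ K then 1 else 0) f *
              signPair (ε' i) e * signPair (ε' j) f) * (signPair x e * signPair x f) := fun x => by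
          rw [crossVec, crossVec, sum_mul_sum]
          exact sum_congr rfl fun e _ => sum_congr rfl fun f _ => by ring
        simp only [this, expect_sum_comm, ← mul_expect, expect_signPair_mul_signPair]
        simp only [mul_ite, mul_one, mul_zero, sum_ite_eq, mem_univ, if_true]
        exact sum_congr rfl fun e _ => by ring
      have e2 : 𝔼 x, trace (vecMulVec (crossVec K ε' x) (crossVec K ε' x) * T) =
          ∑ e, pairProd (fun k => if k ∈ K then 1 else 0) e ^ 2 *
            trace (vecMulVec (fun i => signPair (ε' i) e) (fun i => signPair (ε' i) e) * T) := by
        simp only [trace_vecMulVec_mul, expect_sum_comm, ← expect_mul, e1, mul_sum]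
        conv_rhs => rw [sum_comm]
        refine sum_congr rfl fun i _ => ?_
        conv_rhs => rw [sum_comm]
        refine sum_congr rfl fun k _ => ?_
        rw [sum_mul]
        exact sum_congr rfl fun e _ => by ring
      have e3 : V ε' * (V ε')ᵀ =
          ∑ e, vecMulVec (fun i => signPair (ε' i) e) (fun i => signPair (ε' i) e) := by
        ext i k
        simp [hV, Matrix.sum_apply, vecMulVec_apply, Matrix.mul_apply]
      have e4 : ∀ e : Pairs n, pairProd (fun k => if k ∈ K then (1 : ℝ) else 0) e ^ 2 ≤ 1 :=
        fun e => by
          obtain ⟨k, k', hk, -, rfl⟩ := e.exists_rep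
          simp only [pairProd_mk]
          split_ifs <;> norm_num
      rw [e2]
      calc _ ≤ ∑ e, trace (vecMulVec (fun i => signPair (ε' i) e) (fun i => signPair (ε' i) e) *
              T) := sum_le_sum fun e _ => mul_le_of_le_one_left
            (trace_mul_nonneg (posSemidef_vecMulVec _) hT) (e4 e)
        _ = trace (V ε' * (V ε')ᵀ * T) := by rw [e3, Matrix.sum_mul, trace_sum]
        _ ≤ _ := by simpa using trace_mul_le_trace_mul (hl ε') hT
    · simp only [sum_const, card_univ, Fintype.card_fin, nsmul_eq_mul]
      have : (0 : ℝ) ≤ 1000 * p ^ 3 * n ^ 3 := by positivity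
      linarith
    · simp only [trace_vecMulVec_self, ← pow_succ, sum_const, card_univ, Fintype.card_fin,
        nsmul_eq_mul]
      have hq1 : ((q + 1 : ℕ) : ℝ) ≤ p := by exact_mod_cast hq
      have e3 : 𝔼 x, (∑ j, crossVec K ε' x j ^ 2) ^ (q + 1) ≤
          n ^ (q + 1) * (3 * (12 * (q + 1 : ℕ) * n : ℝ) ^ (2 * (q + 1))) := by
        calc _ ≤ 𝔼 x, (n : ℝ) ^ q * ∑ j, (crossVec K ε' x j ^ 2) ^ (q + 1) := by
              refine expect_le_expect fun x _ => ?_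
              have := pow_sum_le_card_mul_sum_pow (s := univ) (f := fun j => crossVec K ε' x j ^ 2)
                (fun j _ => sq_nonneg _) q
              simpa using this
          _ = (n : ℝ) ^ q * ∑ j, 𝔼 x, (crossVec K ε' x j ^ 2) ^ (q + 1) := by
              rw [← mul_expect, expect_sum_comm]
          _ ≤ (n : ℝ) ^ q * ∑ _j : Fin n, 3 * (12 * (q + 1 : ℕ) * n : ℝ) ^ (2 * (q + 1)) := by
              gcongr with j _
              exact expect_crossVec_pow_le K ε' j (by omega) hn
          _ = _ := by simp; ring
      have hb : (q + 1 : ℝ) ^ q ≤ (p : ℝ) ^ (q + 1) := by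
        calc (q + 1 : ℝ) ^ q ≤ (p : ℝ) ^ q := by gcongr; exact_mod_cast hq
          _ ≤ _ := by gcongr; omega
      calc _ ≤ (p : ℝ) ^ (q + 1) *
              (n * (n ^ (q + 1) * (3 * (12 * p * n : ℝ) ^ (2 * (q + 1))))) := by
            gcongr
            refine e3.trans ?_
            gcongr
        _ = n * 3 * (144 * p ^ 3 * n ^ 3) ^ (q + 1) := by
            rw [pow_mul, show (144 * p ^ 3 * n ^ 3 : ℝ) = p * n * (12 * p * n) ^ 2 by ring,
              mul_pow, mul_pow]; ring
        -- The factor 3 and the division by 2 are absorbed through `6 ≤ 6 ^ (q + 1)`; then `6 * 144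
        -- = 864 ≤ 1000`.
        _ ≤ n * (6 ^ (q + 1) * (144 * p ^ 3 * n ^ 3) ^ (q + 1)) / 2 := by
            have : (6 : ℝ) ≤ 6 ^ (q + 1) := by
              rw [pow_succ]; nlinarith [one_le_pow₀ (show (1 : ℝ) ≤ 6 by norm_num) (n := q)]
            have h7 : (0 : ℝ) ≤ n * (144 * p ^ 3 * n ^ 3) ^ (q + 1) := by positivity
            nlinarith
        _ = n * ((864 * p ^ 3 * n ^ 3) ^ (q + 1)) / 2 := by
            rw [← mul_pow]; congr 3; ring
        _ ≤ _ := by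
            gcongr
            have : (0 : ℝ) ≤ p ^ 3 * n ^ 3 := by positivity
            linarith
  calc _ = 𝔼 ε' : Fin n → Fin n → Bool, 𝔼 ε : Fin n → Fin n → Bool,
        trace (crossGram K ε ε' ^ p) := expect_comm _ _ _
    _ ≤ 𝔼 ε' : Fin n → Fin n → Bool,
        (n : ℝ) * (2 ^ p * ((1000 * p ^ 3 * n ^ 3) ^ p +
          (6 * n) ^ p * trace (pairGram ε' ^ p))) := by
        refine expect_le_expect fun ε' _ => (h1 ε').trans ?_
        gcongr
        refine (add_pow_le_two_pow_mul (by positivity)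
          (mul_nonneg (by positivity) (hl0 ε')) p).trans ?_
        rw [mul_pow (6 * n : ℝ)]
        gcongr
        rw [hVV, ← trace_mul_transpose_pow _ (by omega : p ≠ 0)]
        exact hlq ε' p (by omega)
    _ = (n : ℝ) * (2 ^ p * ((1000 * p ^ 3 * n ^ 3) ^ p +
          (6 * n) ^ p * 𝔼 ε : Fin n → Fin n → Bool, trace (pairGram ε ^ p))) := by
        simp only [← mul_expect, expect_add_distrib, Fintype.expect_const]
    _ ≤ (n : ℝ) * (2 ^ p * ((1000 * p ^ 3 * n ^ 3) ^ p +
          (6 * n) ^ p * (n ^ 2 * (6 * p * n ^ 2 : ℝ) ^ p))) := by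
        gcongr
        exact expect_trace_pairGram_pow_le hp hn
    _ ≤ (n : ℝ) * (2 ^ p * (n ^ 2 * (1000 * p ^ 3 * n ^ 3) ^ p +
          n ^ 2 * (1000 * p ^ 3 * n ^ 3 : ℝ) ^ p)) := by
        have e : (6 * n : ℝ) ^ p * (n ^ 2 * (6 * p * n ^ 2 : ℝ) ^ p) =
            n ^ 2 * (36 * p * n ^ 3 : ℝ) ^ p := by
          rw [mul_left_comm, ← mul_pow]; congr 2; ring
        rw [e]
        gcongr ?_ * (_ * (?_ + _ * ?_ ^ p))
        · have h6 : (1 : ℝ) ≤ n ^ 2 := one_le_pow₀ hn'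
          nlinarith [pow_nonneg (by positivity : (0 : ℝ) ≤ 1000 * p ^ 3 * n ^ 3) p]
        · have : (p : ℝ) ≤ p ^ 3 := by nlinarith [one_le_pow₀ hp' (n := 2)]
          gcongr
          norm_num
    _ = _ := by
        rw [show (2000 * p ^ 3 * n ^ 3 : ℝ) = 2 * (1000 * p ^ 3 * n ^ 3) by ring,
          mul_pow (2 : ℝ) (1000 * p ^ 3 * n ^ 3)]
        ring

end Moments

/-! ### Coupling the random graph with two independent sign matrices -/

section Transfer

/-- Coordinates outside the range of `r` are irrelevant and average out. -/
lemma expect_comp_injective {α β : Type*} [Fintype α] [DecidableEq α] [Fintype β] [DecidableEq β]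
    {r : α → β} (hr : Function.Injective r) (g : (α → Bool) → ℝ) :
    𝔼 ω : β → Bool, g (ω ∘ r) = 𝔼 δ, g δ := by
  classical
  let e : α ⊕ ↥(Set.range r)ᶜ ≃ β :=
    (Equiv.sumCongr (Equiv.ofInjective r hr) (Equiv.refl _)).trans (Equiv.Set.sumCompl _)
  have he : ∀ a, e (Sum.inl a) = r a := fun a => rfl
  let E : (β → Bool) ≃ (α → Bool) × (↥(Set.range r)ᶜ → Bool) :=
    (Equiv.arrowCongr e.symm (Equiv.refl _)).trans (Equiv.sumArrowEquivProdArrow _ _ _)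
  have h1 : 𝔼 ω : β → Bool, g (ω ∘ r) =
      𝔼 q : (α → Bool) × (↥(Set.range r)ᶜ → Bool), g q.1 :=
    Fintype.expect_equiv E _ _ fun ω => rfl
  rw [h1, ← univ_product_univ, expect_product]
  simp

variable {n : ℕ}

/-- The graph with edge indicator `δ`. -/
def graphOf (δ : Pairs n → Bool) : SimpleGraph (Fin n) where
  Adj i j := ∃ h : ¬ (s(i, j) : Sym2 (Fin n)).IsDiag, δ ⟨s(i, j), h⟩ = true
  symm := ⟨fun i j ⟨h, hd⟩ => by
    have e : (s(j, i) : Sym2 (Fin n)) = s(i, j) := Sym2.eq_swap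
    refine ⟨by rwa [e], ?_⟩
    simpa only [e] using hd⟩
  loopless := ⟨fun i ⟨h, _⟩ => h rfl⟩

open scoped Classical in
/-- Graphs correspond to edge indicators. -/
noncomputable def graphEquiv (n : ℕ) : (Pairs n → Bool) ≃ SimpleGraph (Fin n) where
  toFun := graphOf
  invFun G e := decide (e.1 ∈ G.edgeSet)
  left_inv δ := by
    funext e
    obtain ⟨k, l, h, -, rfl⟩ := e.exists_rep
    by_cases hd : δ ⟨s(k, l), h⟩ = true
    · rw [hd, decide_eq_true_eq]
      exact ⟨h, hd⟩
    · rw [Bool.not_eq_true] at hd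
      rw [hd, decide_eq_false_iff_not]
      rintro ⟨_, hd'⟩
      simp [hd] at hd'
  right_inv G := by
    ext i j
    constructor
    · rintro ⟨_, hd⟩
      simpa using hd
    · intro h
      exact ⟨by simpa using h.ne, by simpa using h⟩

lemma signedAdj_graphOf (δ : Pairs n → Bool) {i j : Fin n}
    (h : ¬ (s(i, j) : Sym2 (Fin n)).IsDiag) :
    signedAdj (graphOf δ) i j = sgn (δ ⟨s(i, j), h⟩) := by
  have hij : i ≠ j := by simpa using h
  rw [signedAdj, if_neg hij, sgn]
  have hiff : (graphOf δ).Adj i j ↔ δ ⟨s(i, j), h⟩ = true :=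
    ⟨fun ⟨_, hd⟩ => hd, fun hd => ⟨h, hd⟩⟩
  by_cases hd : δ ⟨s(i, j), h⟩ = true
  · rw [if_pos (hiff.2 hd), if_pos hd]
  · rw [if_neg (mt hiff.1 hd), if_neg hd]

/-- The sign matrices `ε` and `ε'` agree with the signed adjacency matrix of `G` on the entries
from color `0` to color `2` and from color `1` to color `2`, respectively. -/
def Agree (σ : Fin n → Fin 3) (G : SimpleGraph (Fin n)) (ε ε' : Fin n → Fin n → Bool) : Prop :=
  ∀ i k, σ k = 2 → (σ i = 0 → signedAdj G i k = sgn (ε i k)) ∧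
    (σ i = 1 → signedAdj G i k = sgn (ε' i k))

/-- A pair with exactly one endpoint of color 2 is oriented towards that endpoint and placed in the
copy dictated by the other color; every other pair is oriented arbitrarily in the first copy.
Forgetting orientation and copy recovers the pair, which gives injectivity. -/
lemma exists_injective_rep (σ : Fin n → Fin 3) :
    ∃ r : Pairs n → (Fin n × Fin n) ⊕ (Fin n × Fin n), Function.Injective r ∧
      ∀ i k (h : ¬ (s(i, k) : Sym2 (Fin n)).IsDiag), σ k = 2 →
        (σ i = 0 → r ⟨s(i, k), h⟩ = Sum.inl (i, k)) ∧
        (σ i = 1 → r ⟨s(i, k), h⟩ = Sum.inr (i, k)) := by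
  have key : ∀ e : Pairs n, ∃ t : (Fin n × Fin n) ⊕ (Fin n × Fin n),
      Sum.elim (fun q => s(q.1, q.2)) (fun q => s(q.1, q.2)) t = e.1 ∧
      ∀ i k, e.1 = s(i, k) → σ k = 2 → (σ i = 0 → t = Sum.inl (i, k)) ∧
        (σ i = 1 → t = Sum.inr (i, k)) := by
    intro e
    obtain ⟨a, b, h, -, rfl⟩ := e.exists_rep
    have aux : ∀ a b : Fin n, σ b = 2 → σ a ≠ 2 → ∀ i k, s(a, b) = s(i, k) → σ k = 2 →
        σ i ≠ 2 → i = a ∧ k = b := by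
      intro a b hb ha i k hik hk hi
      rcases Sym2.eq_iff.1 hik with ⟨rfl, rfl⟩ | ⟨rfl, rfl⟩
      · exact ⟨rfl, rfl⟩
      · exact absurd hk ha
    have main : ∀ a b : Fin n, σ b = 2 → σ a ≠ 2 → ∃ t : (Fin n × Fin n) ⊕ (Fin n × Fin n),
        Sum.elim (fun q => s(q.1, q.2)) (fun q => s(q.1, q.2)) t = s(a, b) ∧
        ∀ i k, s(a, b) = s(i, k) → σ k = 2 → (σ i = 0 → t = Sum.inl (i, k)) ∧
          (σ i = 1 → t = Sum.inr (i, k)) := by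
      intro a b hb ha
      by_cases h0 : σ a = 0
      · refine ⟨Sum.inl (a, b), rfl, fun i k hik hk => ⟨fun hi => ?_, fun hi => ?_⟩⟩ <;>
          obtain ⟨rfl, rfl⟩ := aux a b hb ha i k hik hk (by rw [hi]; decide)
        · rfl
        · rw [h0] at hi; exact absurd hi (by decide)
      · refine ⟨Sum.inr (a, b), rfl, fun i k hik hk => ⟨fun hi => ?_, fun hi => ?_⟩⟩ <;>
          obtain ⟨rfl, rfl⟩ := aux a b hb ha i k hik hk (by rw [hi]; decide)
        · exact absurd hi h0
        · rfl
    by_cases h1 : σ b = 2 ∧ σ a ≠ 2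
    · exact main a b h1.1 h1.2
    by_cases h2 : σ a = 2 ∧ σ b ≠ 2
    · obtain ⟨t, ht, hik⟩ := main b a h2.1 h2.2
      exact ⟨t, by rw [ht, Sym2.eq_swap], fun i k h => hik i k (by rw [← h, Sym2.eq_swap])⟩
    refine ⟨Sum.inl (a, b), rfl, fun i k hik hk => ?_⟩
    have : σ i = 2 := by
      rcases Sym2.eq_iff.1 hik with ⟨rfl, rfl⟩ | ⟨rfl, rfl⟩
      · by_contra hi; exact h1 ⟨hk, hi⟩
      · by_contra hi; exact h2 ⟨hk, hi⟩
    rw [this]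
    exact ⟨fun h => absurd h (by decide), fun h => absurd h (by decide)⟩
  choose r hr1 hr2 using key
  refine ⟨r, fun e f hef => Subtype.ext ?_, fun i k h => hr2 _ i k rfl⟩
  rw [← hr1 e, hef, hr1]

/-- Averages over graphs are dominated by averages over pairs of independent sign matrices. -/
lemma expect_graph_le (σ : Fin n → Fin 3) {f : SimpleGraph (Fin n) → ℝ}
    {Φ : (Fin n → Fin n → Bool) → (Fin n → Fin n → Bool) → ℝ}
    (h : ∀ G ε ε', Agree σ G ε ε' → f G ≤ Φ ε ε') :
    𝔼 G, f G ≤ 𝔼 ε, 𝔼 ε', Φ ε ε' := by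
  obtain ⟨r, hr, hr'⟩ := exists_injective_rep σ
  have h1 : 𝔼 G, f G = 𝔼 δ, f (graphOf δ) :=
    (Fintype.expect_equiv (graphEquiv n) _ _ fun δ => rfl).symm
  -- The graph is read off the entries of `(ε, ε')` selected by `r`: it is uniform, and agrees with
  -- `(ε, ε')` by construction.
  rw [h1, ← expect_comp_injective hr fun δ => f (graphOf δ)]
  let E : ((Fin n × Fin n) ⊕ (Fin n × Fin n) → Bool) ≃
      (Fin n → Fin n → Bool) × (Fin n → Fin n → Bool) :=
    { toFun := fun ω => (fun i k => ω (Sum.inl (i, k)), fun i k => ω (Sum.inr (i, k)))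
      invFun := fun q => Sum.elim (fun t => q.1 t.1 t.2) (fun t => q.2 t.1 t.2)
      left_inv := fun ω => by funext t; rcases t with ⟨i, k⟩ | ⟨i, k⟩ <;> rfl
      right_inv := fun q => rfl }
  have h2 : 𝔼 ω : (Fin n × Fin n) ⊕ (Fin n × Fin n) → Bool, Φ (E ω).1 (E ω).2 =
      𝔼 ε, 𝔼 ε', Φ ε ε' := by
    rw [Fintype.expect_equiv E _ (fun q => Φ q.1 q.2) fun ω => rfl, ← univ_product_univ,
      expect_product]
  rw [← h2]
  refine expect_le_expect fun ω _ => h _ _ _ fun i k hk => ?_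
  have hnd : σ i ≠ 2 → ¬ (s(i, k) : Sym2 (Fin n)).IsDiag := fun hi h => by
    rw [Sym2.mk_isDiag_iff] at h
    exact hi (h ▸ hk)
  constructor
  · intro hi
    have hd := hnd (by rw [hi]; decide)
    rw [signedAdj_graphOf _ hd, Function.comp_apply, (hr' i k hd hk).1 hi]
    rfl
  · intro hi
    have hd := hnd (by rw [hi]; decide)
    rw [signedAdj_graphOf _ hd, Function.comp_apply, (hr' i k hd hk).2 hi]
    rfl

lemma exists_agree (σ : Fin n → Fin 3) (G : SimpleGraph (Fin n)) : ∃ ε ε', Agree σ G ε ε' := by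
  classical
  refine ⟨fun i k => decide (G.Adj i k), fun i k => decide (G.Adj i k), fun i k hk => ?_⟩
  have : i ≠ k → signedAdj G i k = sgn (decide (G.Adj i k)) := fun h => by
    simp [signedAdj, sgn, h]
  refine ⟨fun hi => this ?_, fun hi => this ?_⟩ <;>
  · rintro rfl
    rw [hk] at hi
    exact absurd hi (by decide)

/-- A function on graphs selecting, for each graph, an agreeing pair of sign matrices at which
`Φ` is smallest. -/
lemma exists_agree_selection (σ : Fin n → Fin 3)
    {Φ : (Fin n → Fin n → Bool) → (Fin n → Fin n → Bool) → ℝ} (hΦ : ∀ ε ε', 0 ≤ Φ ε ε') :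
    ∃ S S' : SimpleGraph (Fin n) → (Fin n → Fin n → Bool), (∀ G, Agree σ G (S G) (S' G)) ∧
      ∀ p : ℕ, 𝔼 G, Φ (S G) (S' G) ^ p ≤ 𝔼 ε, 𝔼 ε', Φ ε ε' ^ p := by
  -- Entries outside the color blocks are not determined by `G`. Taking the minimizer makes the
  -- selection a function of `G` alone, and minimality bounds it by the coupled pair.
  have key : ∀ G, ∃ q : (Fin n → Fin n → Bool) × (Fin n → Fin n → Bool), Agree σ G q.1 q.2 ∧
      ∀ ε ε', Agree σ G ε ε' → Φ q.1 q.2 ≤ Φ ε ε' := by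
    intro G
    obtain ⟨ε, ε', h⟩ := exists_agree σ G
    obtain ⟨q, hq, hmin⟩ := Set.exists_min_image
      {q : (Fin n → Fin n → Bool) × (Fin n → Fin n → Bool) | Agree σ G q.1 q.2}
      (fun q => Φ q.1 q.2)
      (Set.toFinite _) ⟨(ε, ε'), h⟩
    exact ⟨q, hq, fun ε ε' h => hmin (ε, ε') h⟩
  choose q hq hmin using key
  exact ⟨fun G => (q G).1, fun G => (q G).2, hq, fun p => expect_graph_le σ fun G ε ε' h =>
    pow_le_pow_left₀ (hΦ _ _) (hmin G ε ε' h) p⟩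

end Transfer

/-! ### Uniform measure on graphs, Markov and Jensen -/

section Probability

open MeasureTheory

variable {n : ℕ}

lemma measurableSingletonClass_simpleGraph :
    MeasurableSingletonClass (SimpleGraph (Fin n)) where
  measurableSet_singleton G := by
    have : ({G} : Set (SimpleGraph (Fin n))) = SimpleGraph.edgeSet ⁻¹' {G.edgeSet} := by
      ext H; simp
    rw [this]
    exact SimpleGraph.measurableEmbedding_edgeSet.measurable (measurableSet_singleton _)

-- At edge probability `1/2` every graph has mass `2 ^ (-choose n 2)`, so probabilities are averages
-- over all graphs.
open scoped Classical in
lemma randomGraph_real_eq_expect (S : Finset (SimpleGraph (Fin n))) :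
    (randomGraph n).real S = 𝔼 G, if G ∈ S then (1 : ℝ) else 0 := by
  have hms := measurableSingletonClass_simpleGraph (n := n)
  have hprob : IsProbabilityMeasure (randomGraph n) := by
    unfold randomGraph; infer_instance
  have hsing : ∀ G : SimpleGraph (Fin n),
      (randomGraph n).real {G} = ((1 : ℝ) / 2) ^ n.choose 2 := by
    intro G
    have hle : G.edgeSet.ncard ≤ n.choose 2 := by
      have := G.card_edgeFinset_le_card_choose_two
      rw [Fintype.card_fin] at this
      rwa [← SimpleGraph.coe_edgeFinset, Set.ncard_coe_finset]
    have h1 : unitInterval.toNNReal half = (1 / 2 : NNReal) := by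
      ext; simp [half]
    have h2 : unitInterval.toNNReal (unitInterval.symm half) = (1 / 2 : NNReal) := by
      ext; simp [half]; norm_num
    rw [measureReal_def, randomGraph, SimpleGraph.binomialRandom_singleton, h1, h2, Nat.card_fin]
    rw [← pow_add, Nat.add_sub_cancel' hle]
    simp
  have hsum : ∀ S : Finset (SimpleGraph (Fin n)),
      (randomGraph n).real (S : Set (SimpleGraph (Fin n))) = #S * ((1 : ℝ) / 2) ^ n.choose 2 := by
    intro S
    rw [← sum_measureReal_singleton]
    simp [hsing]
  have huniv := hsum univ
  rw [coe_univ, probReal_univ] at huniv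
  rw [hsum, Fintype.expect_eq_sum_div_card]
  simp only [sum_boole, filter_mem_eq_inter, univ_inter]
  have hpos : (0 : ℝ) < #(univ : Finset (SimpleGraph (Fin n))) := by
    by_contra h
    have : (0 : ℝ) < ((1 : ℝ) / 2) ^ n.choose 2 := by positivity
    nlinarith
  rw [card_univ] at huniv hpos
  rw [eq_div_iff hpos.ne', mul_assoc, mul_comm (_ ^ _), ← huniv, mul_one]

/-- Markov's inequality for the `p`-th moment. -/
lemma randomGraph_real_lt_le {f : SimpleGraph (Fin n) → ℝ} (hf : ∀ G, 0 ≤ f G) {p : ℕ} {c t : ℝ}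
    (ht : 0 < t) (h : 𝔼 G, f G ^ p ≤ c) :
    (randomGraph n).real {G | t < f G} ≤ c / t ^ p := by
  classical
  have hcoe : {G | t < f G} = ((univ.filter (t < f ·) : Finset (SimpleGraph (Fin n))) :
      Set (SimpleGraph (Fin n))) := by ext; simp
  rw [hcoe, randomGraph_real_eq_expect, le_div_iff₀ (by positivity), expect_mul]
  refine le_trans (expect_le_expect fun G _ => ?_) h
  simp only [mem_filter, mem_univ, true_and]
  split_ifs with hG
  · rw [one_mul]
    exact pow_le_pow_left₀ ht.le (le_of_lt hG) p
  · simpa using pow_nonneg (hf G) p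

lemma expect_pow_le {ι : Type*} [Fintype ι] [Nonempty ι] {f : ι → ℝ} (hf : ∀ i, 0 ≤ f i) {p : ℕ}
    (hp : p ≠ 0) : (𝔼 i, f i) ^ p ≤ 𝔼 i, f i ^ p := by
  obtain ⟨q, rfl⟩ := Nat.exists_eq_succ_of_ne_zero hp
  have h := pow_sum_le_card_mul_sum_pow (s := univ) (fun i _ => hf i) q
  have hc : (0 : ℝ) < Fintype.card ι := by exact_mod_cast Fintype.card_pos
  rw [Fintype.expect_eq_sum_div_card, Fintype.expect_eq_sum_div_card, div_pow,
    div_le_div_iff₀ (by positivity) hc]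
  rw [card_univ] at h
  calc _ ≤ ((Fintype.card ι : ℝ) ^ q * ∑ i, f i ^ (q + 1)) * Fintype.card ι := by gcongr
    _ = _ := by rw [Nat.succ_eq_add_one, pow_succ (Fintype.card ι : ℝ)]; ring

end Probability

/-! ### Averaging over three-colorings -/

section Decoupling

variable {n : ℕ}

/-- The indicator that the vertex `i` has color `c`. -/
def colorInd (c : Fin 3) (σ : Fin n → Fin 3) (i : Fin n) : ℝ := if σ i = c then 1 else 0

lemma expect_prod_colorInd (T : Finset (Fin n)) (τ : Fin n → Fin 3) :
    𝔼 σ : Fin n → Fin 3, ∏ v ∈ T, colorInd (τ v) σ v = (1 / 3) ^ #T := by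
  have h1 : ∀ σ : Fin n → Fin 3, ∏ v ∈ T, colorInd (τ v) σ v =
      ∏ v, if v ∈ T then (if σ v = τ v then (1 : ℝ) else 0) else 1 := fun σ => by
    rw [prod_ite_mem, univ_inter]; rfl
  simp only [h1]
  rw [Fintype.expect_eq_sum_div_card]
  have h2 := Fintype.prod_sum (fun (v : Fin n) (c : Fin 3) =>
    if v ∈ T then (if c = τ v then (1 : ℝ) else 0) else 1)
  rw [← h2]
  have h3 : ∀ v, ∑ c : Fin 3, (if v ∈ T then (if c = τ v then (1 : ℝ) else 0) else 1) =
      3 * if v ∈ T then 1 / 3 else 1 := fun v => by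
    split_ifs
    · simp
    · norm_num
  simp only [h3, prod_mul_distrib, prod_ite_mem, univ_inter, prod_const, card_univ,
    Fintype.card_fin, Fintype.card_fun]
  push_cast
  field_simp

lemma expect_colorInd_mul_colorInd {i k : Fin n} (h : i ≠ k) :
    𝔼 σ : Fin n → Fin 3, colorInd 0 σ i * colorInd 2 σ k = 1 / 9 := by
  have := expect_prod_colorInd {i, k} (fun v => if v = i then 0 else 2)
  simp only [prod_pair h, if_true, if_neg h.symm, card_pair h] at this
  rw [this]; norm_num

lemma expect_colorInd_mul_pairProd {i j : Fin n} (hij : i ≠ j) {e : Pairs n} (hi : i ∉ e.1)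
    (hj : j ∉ e.1) :
    𝔼 σ : Fin n → Fin 3, colorInd 0 σ i * colorInd 1 σ j * pairProd (colorInd 2 σ) e = 1 / 81 := by
  obtain ⟨k, l, h, hkl, rfl⟩ := e.exists_rep
  simp only [Sym2.mem_iff, not_or] at hi hj
  have := expect_prod_colorInd {i, j, k, l} (fun v => if v = i then 0 else if v = j then 1 else 2)
  have h1 : i ∉ ({j, k, l} : Finset (Fin n)) := by simp [hij, hi]
  have h2 : j ∉ ({k, l} : Finset (Fin n)) := by simp [hj]
  rw [card_insert_of_notMem h1, card_insert_of_notMem h2, card_pair hkl] at this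
  simp only [prod_insert h1, prod_insert h2, prod_pair hkl, if_true, if_neg hij.symm,
    if_neg (Ne.symm hi.1), if_neg (Ne.symm hi.2), if_neg (Ne.symm hj.1),
    if_neg (Ne.symm hj.2)] at this
  simp only [pairProd_mk, mul_assoc]
  rw [this]; norm_num

lemma signedAdj_self (G : SimpleGraph (Fin n)) (i : Fin n) : signedAdj G i i = 0 := by
  simp [signedAdj]

lemma signedAdj_sq (G : SimpleGraph (Fin n)) {i j : Fin n} (h : i ≠ j) :
    signedAdj G i j * signedAdj G i j = 1 := by
  rw [signedAdj, if_neg h]; split_ifs <;> norm_num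

lemma pairProd_signedAdj_eq_zero (G : SimpleGraph (Fin n)) {i : Fin n} {e : Pairs n}
    (h : i ∈ e.1) : pairProd (signedAdj G i) e = 0 := by
  obtain ⟨k, l, hkl, -, rfl⟩ := e.exists_rep
  rcases Sym2.mem_iff.1 h with rfl | rfl <;> simp [signedAdj_self]

lemma pairProd_signedAdj_sq_le (G : SimpleGraph (Fin n)) (i : Fin n) (e : Pairs n) :
    pairProd (signedAdj G i) e ^ 2 ≤ 1 := by
  by_cases h : i ∈ e.1
  · simp [pairProd_signedAdj_eq_zero G h]
  · obtain ⟨k, l, hkl, -, rfl⟩ := e.exists_rep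
    simp only [Sym2.mem_iff, not_or] at h
    rw [pairProd_mk, mul_pow, sq, signedAdj_sq G h.1, sq, signedAdj_sq G h.2, one_mul]

/-- For `j ≠ k` a proportion `1/9` of colorings has `j` of color 0 and `k` of color 2, and there the
sign is the adjacency entry. Both sides vanish for `j = k`. -/
lemma signedAdj_eq_expect {G : SimpleGraph (Fin n)}
    {ε ε' : (Fin n → Fin 3) → Fin n → Fin n → Bool} (hA : ∀ σ, Agree σ G (ε σ) (ε' σ))
    (j k : Fin n) :
    signedAdj G j k = 9 * 𝔼 σ, colorInd 0 σ j * colorInd 2 σ k * sgn (ε σ j k) := by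
  have h : ∀ σ, colorInd 0 σ j * colorInd 2 σ k * sgn (ε σ j k) =
      colorInd 0 σ j * colorInd 2 σ k * signedAdj G j k := fun σ => by
    by_cases hj : σ j = 0
    · by_cases hk : σ k = 2
      · rw [(hA σ j k hk).1 hj]
      · simp [colorInd, hk]
    · simp [colorInd, hj]
  simp only [h, ← expect_mul]
  rcases eq_or_ne j k with rfl | hjk
  · simp [signedAdj_self]
  · rw [expect_colorInd_mul_colorInd hjk]; ring

/-- Four distinct vertices receive prescribed colors in a proportion `1/81` of colorings. If the
pair meets `i` or `j`, both sides vanish. -/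
lemma pairProd_mul_pairProd_eq_expect {G : SimpleGraph (Fin n)}
    {ε ε' : (Fin n → Fin 3) → Fin n → Fin n → Bool} (hA : ∀ σ, Agree σ G (ε σ) (ε' σ))
    {i j : Fin n} (hij : i ≠ j) (e : Pairs n) :
    pairProd (signedAdj G i) e * pairProd (signedAdj G j) e =
      81 * 𝔼 σ, colorInd 0 σ i * colorInd 1 σ j *
        (pairProd (colorInd 2 σ) e * signPair (ε σ i) e * signPair (ε' σ j) e) := by
  have h : ∀ σ, colorInd 0 σ i * colorInd 1 σ j *
        (pairProd (colorInd 2 σ) e * signPair (ε σ i) e * signPair (ε' σ j) e) =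
      colorInd 0 σ i * colorInd 1 σ j * pairProd (colorInd 2 σ) e *
        (pairProd (signedAdj G i) e * pairProd (signedAdj G j) e) := fun σ => by
    by_cases hi : σ i = 0
    · by_cases hj : σ j = 1
      · by_cases he : ∀ k ∈ e.1, σ k = 2
        · have h1 : pairProd (signedAdj G i) e = signPair (ε σ i) e :=
            pairProd_congr fun k hk => (hA σ i k (he k hk)).1 hi
          have h2 : pairProd (signedAdj G j) e = signPair (ε' σ j) e :=
            pairProd_congr fun k hk => (hA σ j k (he k hk)).2 hj
          rw [h1, h2]; ring
        · have : pairProd (colorInd 2 σ) e = 0 := by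
            obtain ⟨k, l, hkl, -, rfl⟩ := e.exists_rep
            simp only [Sym2.mem_iff, forall_eq_or_imp, forall_eq, not_and_or] at he
            rcases he with h | h <;> simp [colorInd, h]
          simp [this]
      · simp [colorInd, hj]
    · simp [colorInd, hi]
  simp only [h, ← expect_mul]
  by_cases hi : i ∈ e.1
  · simp [pairProd_signedAdj_eq_zero G hi]
  by_cases hj : j ∈ e.1
  · simp [pairProd_signedAdj_eq_zero G hj]
  rw [expect_colorInd_mul_pairProd hij hi hj]; ring

lemma expect_sq_le {ι : Type*} [Fintype ι] [Nonempty ι] (f : ι → ℝ) :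
    (𝔼 i, f i) ^ 2 ≤ 𝔼 i, f i ^ 2 := by
  have h := sq_sum_le_card_mul_sum_sq (s := univ) (f := f)
  have hc : (0 : ℝ) < Fintype.card ι := by exact_mod_cast Fintype.card_pos
  rw [Fintype.expect_eq_sum_div_card, Fintype.expect_eq_sum_div_card, div_pow,
    div_le_div_iff₀ (by positivity) hc]
  rw [card_univ] at h
  nlinarith

lemma colorInd_sq_le (c : Fin 3) (σ : Fin n → Fin 3) (i : Fin n) : colorInd c σ i ^ 2 ≤ 1 := by
  rw [colorInd]; split_ifs <;> norm_num

lemma pairProd_colorInd_sq_le (c : Fin 3) (σ : Fin n → Fin 3) (e : Pairs n) :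
    pairProd (colorInd c σ) e ^ 2 ≤ 1 := by
  obtain ⟨k, l, hkl, -, rfl⟩ := e.exists_rep
  rw [pairProd_mk, mul_pow]
  exact mul_le_one₀ (colorInd_sq_le c σ k) (sq_nonneg _) (colorInd_sq_le c σ l)

lemma sum_mul_sq_le {ι : Type*} [Fintype ι] {w : ι → ℝ} (hw : ∀ i, w i ^ 2 ≤ 1) (u : ι → ℝ) :
    ∑ i, (w i * u i) ^ 2 ≤ ∑ i, u i ^ 2 :=
  sum_le_sum fun i _ => by
    rw [mul_pow]; exact mul_le_of_le_one_left (sq_nonneg _) (hw i)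

/-- Quadratic forms of sums of rank one matrices. -/
lemma sum_sq_le_of_posSemidef {ι κ : Type*} [Fintype ι] [DecidableEq ι] [Fintype κ]
    {v : κ → ι → ℝ} {l : ℝ}
    (h : (l • (1 : Matrix ι ι ℝ) - ∑ i, vecMulVec (v i) (v i)).PosSemidef) (u : ι → ℝ) :
    ∑ i, (∑ k, u k * v i k) ^ 2 ≤ l * ∑ k, u k ^ 2 := by
  have := (posSemidef_smul_one_sub_iff
    (posSemidef_sum univ fun i _ => posSemidef_vecMulVec (v i)).1).1 h u
  rwa [Matrix.sum_mulVec, dotProduct_sum, sum_congr rfl fun i _ =>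
    dotProduct_vecMulVec_mulVec (v i) u] at this

end Decoupling

/-! ### High-probability estimates for the random graph -/

section Events

open MeasureTheory

variable {n : ℕ}

instance : IsProbabilityMeasure (randomGraph n) := by unfold randomGraph; infer_instance

/-- With high probability, the sign matrices in all the decouplings can be selected so that `Φ` is
small on average. -/
lemma randomGraph_real_not_exists_agree_le
    {Φ : (Fin n → Fin 3) → (Fin n → Fin n → Bool) → (Fin n → Fin n → Bool) → ℝ}
    (h0 : ∀ σ ε ε', 0 ≤ Φ σ ε ε') {p : ℕ} (hp : p ≠ 0) {c Q t : ℝ} (hQ : 0 < Q) (ht : 0 < t)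
    (h : ∀ σ, 𝔼 ε, 𝔼 ε', Φ σ ε ε' ^ p ≤ c * Q ^ p) :
    (randomGraph n).real {G | ¬ ∃ ε ε' : (Fin n → Fin 3) → Fin n → Fin n → Bool,
      (∀ σ, Agree σ G (ε σ) (ε' σ)) ∧ 𝔼 σ, Φ σ (ε σ) (ε' σ) ≤ t * Q} ≤ c / t ^ p := by
  choose S S' hS hE using fun σ => exists_agree_selection σ (h0 σ)
  -- Jensen over the colorings: there are `3 ^ n` of them, so a union bound is not available, but an
  -- average bound is all that decoupling needs.
  have h1 : 𝔼 G, (𝔼 σ, Φ σ (S σ G) (S' σ G)) ^ p ≤ c * Q ^ p := by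
    calc _ ≤ 𝔼 G, 𝔼 σ, Φ σ (S σ G) (S' σ G) ^ p :=
          expect_le_expect fun G _ => expect_pow_le (fun σ => h0 _ _ _) hp
      _ = 𝔼 σ, 𝔼 G, Φ σ (S σ G) (S' σ G) ^ p := expect_comm _ _ _
      _ ≤ 𝔼 _σ : Fin n → Fin 3, c * Q ^ p :=
          expect_le_expect fun σ _ => (hE σ p).trans (h σ)
      _ = _ := Fintype.expect_const _
  have h2 := randomGraph_real_lt_le (fun G => expect_nonneg fun σ _ => h0 σ (S σ G) (S' σ G))
    (mul_pos ht hQ) h1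
  have h3 : c * Q ^ p / (t * Q) ^ p = c / t ^ p := by
    rw [mul_pow, mul_div_mul_right _ _ (by positivity)]
  rw [h3] at h2
  refine le_trans (measureReal_mono fun G hG => ?_) h2
  by_contra hlt
  exact hG ⟨fun σ => S σ G, fun σ => S' σ G, fun σ => hS σ G, not_lt.1 hlt⟩

/-- The decoupling factor 9 enters squared, by Jensen, as 81. -/
lemma randomGraph_real_adj_norm_le {p : ℕ} (hp : 1 ≤ p) (hn : 1 ≤ n) {t : ℝ} (ht : 0 < t) :
    (randomGraph n).real {G | ¬ ∀ x : Fin n → ℝ,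
      ∑ j, (∑ k, x k * signedAdj G j k) ^ 2 ≤ 81 * (t * (6 * p * n)) * ∑ k, x k ^ 2} ≤
      n / t ^ p := by
  have hn' : (0 : ℝ) < n := by exact_mod_cast hn
  have hp' : (0 : ℝ) < p := by exact_mod_cast hp
  choose l hl0 hl hlq using fun ε : Fin n → Fin n → Bool =>
    exists_le_smul_one_and_pow_le_trace (posSemidef_rowGram ε)
  refine le_trans (measureReal_mono fun G hG => ?_) (randomGraph_real_not_exists_agree_le
    (Φ := fun _ ε _ => l ε) (fun _ ε _ => hl0 ε) (by omega : p ≠ 0) (c := n) (Q := 6 * p * n)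
    (by positivity) ht fun σ => ?_)
  · rw [Set.mem_ofPred_eq] at hG ⊢
    rintro ⟨ε, ε', hA, hE⟩
    apply hG
    intro x
    have h1 : ∀ j, ∑ k, x k * signedAdj G j k =
        9 * 𝔼 σ, colorInd 0 σ j * ∑ k, (colorInd 2 σ k * x k) * sgn (ε σ j k) := fun j => by
      simp only [mul_sum, expect_sum_comm]
      refine sum_congr rfl fun k _ => ?_
      rw [signedAdj_eq_expect hA j k, mul_left_comm, mul_expect]
      congr 1
      exact expect_congr rfl fun σ _ => by ring
    calc ∑ j, (∑ k, x k * signedAdj G j k) ^ 2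
        ≤ ∑ j, 81 * 𝔼 σ, (∑ k, (colorInd 2 σ k * x k) * sgn (ε σ j k)) ^ 2 := by
          refine sum_le_sum fun j _ => ?_
          rw [h1, mul_pow]
          norm_num only
          gcongr
          refine (expect_sq_le _).trans (expect_le_expect fun σ _ => ?_)
          rw [mul_pow]
          exact mul_le_of_le_one_left (sq_nonneg _) (colorInd_sq_le _ _ _)
      _ = 81 * 𝔼 σ, ∑ j, (∑ k, (colorInd 2 σ k * x k) * sgn (ε σ j k)) ^ 2 := by
          rw [← mul_sum, expect_sum_comm]
      _ ≤ 81 * 𝔼 σ, l (ε σ) * ∑ k, x k ^ 2 := by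
          gcongr with σ _
          exact (sum_sq_le_of_posSemidef (hl (ε σ)) _).trans (mul_le_mul_of_nonneg_left
            (sum_mul_sq_le (fun k => colorInd_sq_le 2 σ k) x) (hl0 _))
      _ ≤ _ := by
          rw [← expect_mul, ← mul_assoc]
          gcongr
  · simp only [Fintype.expect_const]
    exact (expect_le_expect fun ε _ => hlq ε p (by omega)).trans (expect_trace_rowGram_pow_le hp)

lemma randomGraph_real_prod_norm_le {p : ℕ} (hp : 1 ≤ p) (hn : 1 ≤ n) {t : ℝ} (ht : 0 < t) :
    (randomGraph n).real {G | ¬ ∀ u : Pairs n → ℝ,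
      ∑ j, ∑ i, (if i = j then 0 else
        (∑ e, u e * (pairProd (signedAdj G i) e * pairProd (signedAdj G j) e)) ^ 2) ≤
        6561 * (t * (12 * p ^ 2 * n ^ 2)) * ∑ e, u e ^ 2} ≤ 2 * n ^ 4 / t ^ p := by
  have hn' : (0 : ℝ) < n := by exact_mod_cast hn
  have hp' : (0 : ℝ) < p := by exact_mod_cast hp
  choose l hl0 hl hlq using fun ε ε' : Fin n → Fin n → Bool =>
    exists_le_smul_one_and_pow_le_trace (posSemidef_prodGram ε ε')
  refine le_trans (measureReal_mono fun G hG => ?_) (randomGraph_real_not_exists_agree_le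
    (Φ := fun _ ε ε' => l ε ε') (fun _ ε ε' => hl0 ε ε') (by omega : p ≠ 0) (c := 2 * n ^ 4)
    (Q := 12 * p ^ 2 * n ^ 2) (by positivity) ht fun σ => ?_)
  · rw [Set.mem_ofPred_eq] at hG ⊢
    rintro ⟨ε, ε', hA, hE⟩
    apply hG
    intro u
    have h1 : ∀ i j, i ≠ j →
        ∑ e, u e * (pairProd (signedAdj G i) e * pairProd (signedAdj G j) e) =
        81 * 𝔼 σ, (colorInd 0 σ i * colorInd 1 σ j) *
          ∑ e, (pairProd (colorInd 2 σ) e * u e) * (signPair (ε σ i) e * signPair (ε' σ j) e) :=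
      fun i j hij => by
        simp only [mul_sum, expect_sum_comm]
        refine sum_congr rfl fun e _ => ?_
        rw [pairProd_mul_pairProd_eq_expect hA hij e, mul_left_comm, mul_expect]
        congr 1
        exact expect_congr rfl fun σ _ => by ring
    have hsq : ∀ ε ε' : Fin n → Fin n → Bool, ∀ w : Pairs n → ℝ,
        ∑ j, ∑ i, (∑ e, w e * (signPair (ε i) e * signPair (ε' j) e)) ^ 2 ≤
          l ε ε' * ∑ e, w e ^ 2 := fun ε ε' w => by
      have h2 : prodGram ε ε' = ∑ q : Fin n × Fin n,
          vecMulVec (fun e => signPair (ε q.2) e * signPair (ε' q.1) e)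
            (fun e => signPair (ε q.2) e * signPair (ε' q.1) e) := by
        rw [prodGram, ← univ_product_univ, sum_product]
      have h3 := hl ε ε'
      rw [h2] at h3
      have := sum_sq_le_of_posSemidef h3 w
      rwa [← univ_product_univ, sum_product] at this
    calc _ ≤ ∑ j, ∑ i, 6561 * 𝔼 σ, (∑ e, (pairProd (colorInd 2 σ) e * u e) *
            (signPair (ε σ i) e * signPair (ε' σ j) e)) ^ 2 := by
          refine sum_le_sum fun j _ => sum_le_sum fun i _ => ?_
          split_ifs with hij
          · exact mul_nonneg (by norm_num) (expect_nonneg fun σ _ => sq_nonneg _)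
          rw [h1 i j hij, mul_pow]
          norm_num only
          gcongr
          refine (expect_sq_le _).trans (expect_le_expect fun σ _ => ?_)
          rw [mul_pow]
          refine mul_le_of_le_one_left (sq_nonneg _) ?_
          rw [mul_pow]
          exact mul_le_one₀ (colorInd_sq_le _ _ _) (sq_nonneg _) (colorInd_sq_le _ _ _)
      _ = 6561 * 𝔼 σ, ∑ j, ∑ i, (∑ e, (pairProd (colorInd 2 σ) e * u e) *
            (signPair (ε σ i) e * signPair (ε' σ j) e)) ^ 2 := by
          simp only [← mul_sum, expect_sum_comm]
      _ ≤ 6561 * 𝔼 σ, l (ε σ) (ε' σ) * ∑ e, u e ^ 2 := by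
          gcongr with σ _
          exact (hsq _ _ _).trans (mul_le_mul_of_nonneg_left
            (sum_mul_sq_le (fun e => pairProd_colorInd_sq_le 2 σ e) u) (hl0 _ _))
      _ ≤ _ := by
          rw [← expect_mul, ← mul_assoc]
          gcongr
  · exact (expect_le_expect fun ε _ => expect_le_expect fun ε' _ => hlq ε ε' p (by omega)).trans
      (expect_trace_prodGram_pow_le hp hn)

lemma randomGraph_real_cross_norm_le {p : ℕ} (hp : 1 ≤ p) (hn : 1 ≤ n) {t : ℝ} (ht : 0 < t) :
    (randomGraph n).real {G | ¬ ∀ c : Fin n → ℝ,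
      (∑ i, ∑ j, if i = j then 0 else c i * c j *
        ∑ e, pairProd (signedAdj G i) e * pairProd (signedAdj G j) e) ^ 2 ≤
        6561 * (t * (2000 * p ^ 3 * n ^ 3)) * (∑ i, c i ^ 2) ^ 2} ≤ 2 * n ^ 3 / t ^ p := by
  have hn' : (0 : ℝ) < n := by exact_mod_cast hn
  have hp' : (0 : ℝ) < p := by exact_mod_cast hp
  choose l hl0 hl hlq using fun (K : Finset (Fin n)) (ε ε' : Fin n → Fin n → Bool) =>
    exists_le_smul_one_and_pow_le_trace (posSemidef_crossGram K ε ε')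
  refine le_trans (measureReal_mono fun G hG => ?_) (randomGraph_real_not_exists_agree_le
    (Φ := fun σ ε ε' => l (univ.filter (σ · = 2)) ε ε') (fun _ _ _ => hl0 _ _ _)
    (by omega : p ≠ 0) (c := 2 * n ^ 3) (Q := 2000 * p ^ 3 * n ^ 3) (by positivity) ht fun σ => ?_)
  · rw [Set.mem_ofPred_eq] at hG ⊢
    rintro ⟨ε, ε', hA, hE⟩
    apply hG
    intro c
    have h1 : ∀ i j, (if i = j then 0 else c i * c j *
        ∑ e, pairProd (signedAdj G i) e * pairProd (signedAdj G j) e) =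
        81 * 𝔼 σ, (colorInd 0 σ i * c i) * ((colorInd 1 σ j * c j) *
          crossVec (univ.filter (σ · = 2)) (ε' σ) (ε σ i) j) := fun i j => by
      split_ifs with hij
      · subst hij
        -- A vertex cannot have colors 0 and 1 at once, so decoupling discards the diagonal by
        -- itself.
        have : ∀ σ : Fin n → Fin 3, colorInd 0 σ i * c i * ((colorInd 1 σ i * c i) *
          crossVec (univ.filter (σ · = 2)) (ε' σ) (ε σ i) i) = 0 := fun σ => by
          by_cases h0 : σ i = 0 <;> simp [colorInd, h0]
        simp [this]
      · have hcv : ∀ σ : Fin n → Fin 3, (fun k : Fin n =>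
            if k ∈ univ.filter (σ · = 2) then (1 : ℝ) else 0) = colorInd 2 σ := fun σ => by
          funext k; simp [colorInd]
        simp only [crossVec, hcv, mul_sum, expect_sum_comm]
        refine sum_congr rfl fun e _ => ?_
        rw [pairProd_mul_pairProd_eq_expect hA hij e, mul_left_comm, mul_expect]
        congr 1
        exact expect_congr rfl fun σ _ => by ring
    have h2 : (∑ i, ∑ j, if i = j then 0 else c i * c j *
        ∑ e, pairProd (signedAdj G i) e * pairProd (signedAdj G j) e) =
        81 * 𝔼 σ, ∑ i, (colorInd 0 σ i * c i) * ∑ j, (colorInd 1 σ j * c j) *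
          crossVec (univ.filter (σ · = 2)) (ε' σ) (ε σ i) j := by
      simp only [h1]
      simp only [mul_sum, expect_sum_comm]
    rw [h2, mul_pow]
    calc _ ≤ 6561 * 𝔼 σ, (∑ i, (colorInd 0 σ i * c i) * ∑ j, (colorInd 1 σ j * c j) *
          crossVec (univ.filter (σ · = 2)) (ε' σ) (ε σ i) j) ^ 2 := by
          norm_num only
          gcongr
          exact expect_sq_le _
      _ ≤ 6561 * 𝔼 σ, (∑ i, c i ^ 2) * (l (univ.filter (σ · = 2)) (ε σ) (ε' σ) *
            ∑ i, c i ^ 2) := by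
          gcongr with σ _
          refine (sum_mul_sq_le_sq_mul_sq _ _ _).trans ?_
          refine mul_le_mul (sum_mul_sq_le (fun i => colorInd_sq_le 0 σ i) c) ?_
            (sum_nonneg fun i _ => sq_nonneg _) (sum_nonneg fun i _ => sq_nonneg _)
          exact (sum_sq_le_of_posSemidef (hl _ (ε σ) (ε' σ)) _).trans (mul_le_mul_of_nonneg_left
            (sum_mul_sq_le (fun j => colorInd_sq_le 1 σ j) c) (hl0 _ _ _))
      _ = 6561 * (𝔼 σ, l (univ.filter (σ · = 2)) (ε σ) (ε' σ)) * (∑ i, c i ^ 2) ^ 2 := by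
          rw [← mul_expect, ← expect_mul]; ring
      _ ≤ _ := by gcongr
  · exact (expect_le_expect fun ε _ => expect_le_expect fun ε' _ => hlq _ ε ε' p (by omega)).trans
      (expect_trace_crossGram_pow_le _ hp hn)

lemma randomGraph_real_row_sum_le {p : ℕ} (hp : 1 ≤ p) (hn : 1 ≤ n) {t : ℝ} (ht : 0 < t) :
    (randomGraph n).real {G | ¬ ∀ j, (∑ k, signedAdj G j k) ^ 2 ≤ t * (6 * p * n)} ≤
      2 * n / t ^ p := by
  have hn' : (0 : ℝ) < n := by exact_mod_cast hn
  have hp' : (0 : ℝ) < p := by exact_mod_cast hp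
  have h1 : ∀ j, 𝔼 G : SimpleGraph (Fin n), ((∑ k, signedAdj G j k) ^ 2) ^ p ≤
      2 * (6 * p * n : ℝ) ^ p := fun j => by
    -- One coloring is enough for a single row: `j` has color 0 and all other vertices have color 2,
    -- so no constant is lost.
    refine (expect_graph_le (Function.update (fun _ => 2) j 0)
      (Φ := fun ε _ => (∑ k ∈ univ.erase j, sgn (ε j k)) ^ (2 * p)) fun G ε ε' hA => ?_).trans ?_
    · rw [← pow_mul, ← sum_erase_add _ _ (mem_univ j), signedAdj_self, add_zero]
      refine le_of_eq ?_
      congr 1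
      refine sum_congr rfl fun k hk => (hA j k ?_).1 (Function.update_self _ _ _)
      exact Function.update_of_ne (ne_of_mem_erase hk) _ _
    · simp only [Fintype.expect_const]
      rw [expect_apply_coord j fun x : Fin n → Bool =>
        (∑ k ∈ univ.erase j, sgn (x k)) ^ (2 * p)]
      exact expect_sum_sgn_pow_le _ (by omega) hn
  have h2 : ∀ j, (randomGraph n).real {G | t * (6 * p * n) < (∑ k, signedAdj G j k) ^ 2} ≤
      2 / t ^ p := fun j => by
    have := randomGraph_real_lt_le (fun G => sq_nonneg (∑ k, signedAdj G j k))
      (mul_pos ht (by positivity : (0 : ℝ) < 6 * p * n)) (h1 j)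
    rwa [mul_pow t, mul_div_mul_right _ _ (by positivity)] at this
  calc _ ≤ (randomGraph n).real (⋃ j, {G | t * (6 * p * n) < (∑ k, signedAdj G j k) ^ 2}) := by
        refine measureReal_mono fun G hG => ?_
        simpa using hG
    _ ≤ ∑ j, (randomGraph n).real {G | t * (6 * p * n) < (∑ k, signedAdj G j k) ^ 2} :=
        measureReal_iUnion_fintype_le _
    _ ≤ ∑ _j : Fin n, 2 / t ^ p := sum_le_sum fun j _ => h2 j
    _ = _ := by simp; ring

end Events

/-! ### Deterministic reduction to the spectral estimates -/

section Deterministic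

variable {n : ℕ}

lemma inner_eq_sum (u v : PairSpace n) : inner ℝ u v = ∑ e, u e * v e := by
  rw [PiLp.inner_apply]
  exact sum_congr rfl fun e _ => by simp [mul_comm]

lemma norm_sq_eq_sum (u : PairSpace n) : ‖u‖ ^ 2 = ∑ e, u e ^ 2 := by
  rw [← real_inner_self_eq_norm_sq, inner_eq_sum]
  exact sum_congr rfl fun e _ => (sq _).symm

lemma inner_starProjection_self (K : Submodule ℝ (PairSpace n)) (u : PairSpace n) :
    inner ℝ (K.starProjection u) u = ‖K.starProjection u‖ ^ 2 := by
  have := K.starProjection_inner_eq_zero u _ (K.starProjection_apply_mem u)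
  rw [inner_sub_left, sub_eq_zero] at this
  rw [real_inner_comm, this, real_inner_self_eq_norm_sq]

lemma starVec_apply (G : SimpleGraph (Fin n)) (i : Fin n) (e : Pairs n) :
    starVec G i e = pairProd (signedAdj G i) e := rfl

lemma starDiag_apply (G : SimpleGraph (Fin n)) (i : Fin n) (u : PairSpace n) (e : Pairs n) :
    starDiag G i u e = pairProd (signedAdj G i) e * u e := by
  simp [starDiag, Matrix.mulVec_diagonal, starVec_apply]

lemma inner_starDiag_left (G : SimpleGraph (Fin n)) (i : Fin n) (u v : PairSpace n) :
    inner ℝ (starDiag G i u) v = inner ℝ u (starDiag G i v) := by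
  simp only [inner_eq_sum, starDiag_apply]
  exact sum_congr rfl fun e _ => by ring

lemma norm_starDiag_sq_le (G : SimpleGraph (Fin n)) (i : Fin n) (u : PairSpace n) :
    ‖starDiag G i u‖ ^ 2 ≤ ‖u‖ ^ 2 := by
  simp only [norm_sq_eq_sum, starDiag_apply]
  exact sum_mul_sq_le (pairProd_signedAdj_sq_le G i) _

lemma sum_signedAdj_sq (G : SimpleGraph (Fin n)) (i : Fin n) :
    ∑ k, signedAdj G i k ^ 2 = n - 1 := by
  have h : ∀ k, signedAdj G i k ^ 2 = 1 - if i = k then 1 else 0 := fun k => by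
    split_ifs with h
    · subst h; simp [signedAdj_self]
    · rw [sq, signedAdj_sq G h]; simp
  simp [h]

lemma two_mul_card_pairs : 2 * ∑ _e : Pairs n, (1 : ℝ) = n ^ 2 - n := by
  have := two_mul_sum_pairProd (n := n) fun _ => 1
  have h1 : ∀ e : Pairs n, pairProd (fun _ => (1 : ℝ)) e = 1 := fun e => by
    obtain ⟨k, l, h, -, rfl⟩ := e.exists_rep
    simp
  simp only [h1] at this
  rw [this]
  simp

lemma two_mul_sum_pairProd_signedAdj_sq (G : SimpleGraph (Fin n)) (i : Fin n) :
    2 * ∑ e, pairProd (signedAdj G i) e ^ 2 = (n - 1) * (n - 2) := by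
  have h := two_mul_sum_pairProd (n := n) fun k => signedAdj G i k * signedAdj G i k
  have h1 : ∀ k, (signedAdj G i k * signedAdj G i k) ^ 2 = signedAdj G i k ^ 2 := fun k => by
    rcases eq_or_ne i k with rfl | hk
    · simp [signedAdj_self]
    · rw [sq (signedAdj G i k), signedAdj_sq G hk]; simp
  simp only [pairProd_mul, h1] at h
  simp only [← sq, sum_signedAdj_sq] at h
  rw [h]; ring

/-- The lower bound on the Gram matrix of the star vectors. -/
lemma le_norm_sum_smul_starVec_sq (hn : 6 ≤ n) {G : SimpleGraph (Fin n)}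
    (hC : ∀ c : Fin n → ℝ, (∑ i, ∑ j, if i = j then 0 else c i * c j *
      ∑ e, pairProd (signedAdj G i) e * pairProd (signedAdj G j) e) ^ 2 ≤
      ((n : ℝ) ^ 2 / 8 * ∑ i, c i ^ 2) ^ 2) (c : Fin n → ℝ) :
    (n : ℝ) ^ 2 / 8 * ∑ i, c i ^ 2 ≤ ‖∑ i, c i • starVec G i‖ ^ 2 := by
  have hn' : (6 : ℝ) ≤ n := by exact_mod_cast hn
  have hS : 0 ≤ ∑ i, c i ^ 2 := sum_nonneg fun i _ => sq_nonneg _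
  have h1 : ‖∑ i, c i • starVec G i‖ ^ 2 = ∑ i, ∑ j, c i * c j *
      ∑ e, pairProd (signedAdj G i) e * pairProd (signedAdj G j) e := by
    rw [← real_inner_self_eq_norm_sq, sum_inner]
    refine sum_congr rfl fun i _ => ?_
    rw [inner_sum]
    refine sum_congr rfl fun j _ => ?_
    rw [real_inner_smul_left, real_inner_smul_right, inner_eq_sum, mul_assoc]
    rfl
  have h2 : ∀ i j, c i * c j *
      ∑ e, pairProd (signedAdj G i) e * pairProd (signedAdj G j) e =
      (if i = j then c i ^ 2 * ((n - 1) * (n - 2) / 2) else 0) + if i = j then 0 else c i * c j *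
      ∑ e, pairProd (signedAdj G i) e * pairProd (signedAdj G j) e := fun i j => by
    split_ifs with h
    · subst h
      have := two_mul_sum_pairProd_signedAdj_sq G i
      simp only [← sq]
      rw [add_zero, ← this]; ring
    · simp
  -- The diagonal of the Gram matrix is at least `n² / 4` once `n ≥ 6`, twice what the off-diagonal
  -- form can remove.
  have h3 : (n : ℝ) ^ 2 / 4 ≤ (n - 1) * (n - 2) / 2 := by nlinarith
  have h4 := abs_le_of_sq_le_sq' (hC c) (by positivity)
  rw [h1, sum_congr rfl fun i _ => sum_congr rfl fun j _ => h2 i j]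
  simp only [sum_add_distrib, sum_ite_eq, mem_univ, if_true, ← sum_mul]
  nlinarith [h4.1]

/-- Write the projection as `∑ c_j a_j`. Its squared norm is `∑ c_j ⟨a_j, z⟩`; Cauchy–Schwarz and
the Gram lower bound, which controls `∑ c_j²` by that same squared norm, leave one factor to cancel.
-/
lemma norm_projW_sq_le (hn : 1 ≤ n) {G : SimpleGraph (Fin n)}
    (hG : ∀ c : Fin n → ℝ, (n : ℝ) ^ 2 / 8 * ∑ i, c i ^ 2 ≤ ‖∑ i, c i • starVec G i‖ ^ 2)
    (z : PairSpace n) :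
    ‖projW G z‖ ^ 2 ≤ 8 / n ^ 2 * ∑ j, inner ℝ (starVec G j) z ^ 2 := by
  have hn' : (0 : ℝ) < n := by exact_mod_cast hn
  obtain ⟨c, hc⟩ := (Submodule.mem_span_range_iff_exists_fun ℝ).1
    ((spaceW G).starProjection_apply_mem z)
  have h1 : ‖projW G z‖ ^ 2 = ∑ j, c j * inner ℝ (starVec G j) z := by
    have : inner ℝ (projW G z) z = ‖projW G z‖ ^ 2 := inner_starProjection_self _ z
    rw [← this, projW, ← hc, sum_inner]
    exact sum_congr rfl fun j _ => real_inner_smul_left _ _ _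
  have h2 : (‖projW G z‖ ^ 2) ^ 2 ≤ (∑ j, c j ^ 2) * ∑ j, inner ℝ (starVec G j) z ^ 2 := by
    rw [h1]; exact sum_mul_sq_le_sq_mul_sq _ _ _
  have h3 := hG c
  rw [hc] at h3
  change _ ≤ ‖projW G z‖ ^ 2 at h3
  set y := ‖projW G z‖ ^ 2
  set S := ∑ j, inner ℝ (starVec G j) z ^ 2
  have hS : 0 ≤ S := sum_nonneg fun j _ => sq_nonneg _
  have h5 : ∑ j, c j ^ 2 ≤ 8 / n ^ 2 * y := by
    rw [div_mul_eq_mul_div, le_div_iff₀ (by positivity)]; linarith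
  have h6 : y ^ 2 ≤ 8 / n ^ 2 * y * S := h2.trans (by gcongr)
  have hy : 0 ≤ y := sq_nonneg _
  rcases hy.eq_or_lt with h0 | h0
  · rw [← h0]; positivity
  · refine le_of_mul_le_mul_left ?_ h0
    calc _ = y ^ 2 := by ring
      _ ≤ _ := h6
      _ = _ := by ring

/-- The vectors whose entry at `{k, l}` is `x k + x l` for some `x`. -/
def vertexSums (n : ℕ) : Submodule ℝ (PairSpace n) where
  carrier := {w | ∃ x : Fin n → ℝ, ∀ (k l : Fin n) (h : ¬ (s(k, l) : Sym2 (Fin n)).IsDiag),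
    w ⟨s(k, l), h⟩ = x k + x l}
  add_mem' := by
    rintro a b ⟨x, hx⟩ ⟨y, hy⟩
    exact ⟨fun k => x k + y k, fun k l h => by rw [PiLp.add_apply, hx, hy]; ring⟩
  zero_mem' := ⟨fun _ => 0, fun k l h => by simp⟩
  smul_mem' := by
    rintro r a ⟨x, hx⟩
    exact ⟨fun k => r * x k, fun k l h => by rw [PiLp.smul_apply, hx, smul_eq_mul]; ring⟩

lemma spaceV0_sup_spaceV1_le : spaceV0 n ⊔ spaceV1 n ≤ vertexSums n := by
  refine sup_le (Submodule.span_le.2 ?_) (Submodule.span_le.2 fun u hu => hu.2)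
  rintro _ rfl
  exact ⟨fun _ => 1 / 2, fun k l h => by simp [onesVec]; norm_num⟩

/-- The exact value is `(n - 2) ∑ x_k² + (∑ x_k)²`. -/
lemma norm_sq_vertexSum {w : PairSpace n} {x : Fin n → ℝ}
    (hx : ∀ (k l : Fin n) (h : ¬ (s(k, l) : Sym2 (Fin n)).IsDiag), w ⟨s(k, l), h⟩ = x k + x l) :
    (n - 2 : ℝ) * ∑ k, x k ^ 2 ≤ ‖w‖ ^ 2 := by
  have h1 := sum_pairs_eq (n := n)
    (Sym2.lift ⟨fun k l => (x k + x l) ^ 2, fun _ _ => by ring⟩)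
  have h2 : ∀ e : Pairs n, w e ^ 2 =
      Sym2.lift ⟨fun k l => (x k + x l) ^ 2, fun _ _ => by ring⟩ e.1 := fun e => by
    obtain ⟨k, l, h, -, rfl⟩ := e.exists_rep
    rw [hx]; rfl
  have h3 : ∀ k, (∑ l, if k = l then 0 else
      Sym2.lift ⟨fun k l => (x k + x l) ^ 2, fun _ _ => by ring⟩ s(k, l)) =
      n * x k ^ 2 + 2 * x k * ∑ l, x l + ∑ l, x l ^ 2 - 4 * x k ^ 2 := fun k => by
    have : ∀ l, (if k = l then 0 else
        Sym2.lift ⟨fun k l => (x k + x l) ^ 2, fun _ _ => by ring⟩ s(k, l)) =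
        x k ^ 2 + 2 * x k * x l + x l ^ 2 - if k = l then 4 * x k ^ 2 else 0 := fun l => by
      split_ifs with h
      · subst h; ring
      · simp only [Sym2.lift_mk]; ring
    simp only [this, sum_sub_distrib, sum_add_distrib, ← mul_sum, sum_ite_eq, mem_univ, if_true,
      sum_const, card_univ, Fintype.card_fin, nsmul_eq_mul]
  rw [norm_sq_eq_sum, sum_congr rfl fun e _ => h2 e]
  simp only [h3, sum_sub_distrib, sum_add_distrib, ← mul_sum, ← sum_mul, sum_const, card_univ,
    Fintype.card_fin, nsmul_eq_mul] at h1
  nlinarith [sq_nonneg (∑ k, x k)]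

lemma inner_starVec_vertexSum (G : SimpleGraph (Fin n)) (j : Fin n) {w : PairSpace n}
    {x : Fin n → ℝ}
    (hx : ∀ (k l : Fin n) (h : ¬ (s(k, l) : Sym2 (Fin n)).IsDiag), w ⟨s(k, l), h⟩ = x k + x l) :
    inner ℝ (starVec G j) w = (∑ k, signedAdj G j k) * ∑ k, x k * signedAdj G j k -
      ∑ k, x k * signedAdj G j k ^ 2 := by
  set r := signedAdj G j with hr
  have h1 := sum_pairs_eq (n := n)
    (Sym2.lift ⟨fun k l => r k * r l * (x k + x l), fun _ _ => by ring⟩)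
  have h2 : ∀ e : Pairs n, starVec G j e * w e =
      Sym2.lift ⟨fun k l => r k * r l * (x k + x l), fun _ _ => by ring⟩ e.1 := fun e => by
    obtain ⟨k, l, h, -, rfl⟩ := e.exists_rep
    rw [hx]; rfl
  have h3 : ∀ k, (∑ l, if k = l then 0 else
      Sym2.lift ⟨fun k l => r k * r l * (x k + x l), fun _ _ => by ring⟩ s(k, l)) =
      x k * r k * ∑ l, r l + r k * ∑ l, x l * r l - 2 * (x k * r k ^ 2) := fun k => by
    have : ∀ l, (if k = l then 0 else
        Sym2.lift ⟨fun k l => r k * r l * (x k + x l), fun _ _ => by ring⟩ s(k, l)) =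
        x k * r k * r l + r k * (x l * r l) - if k = l then 2 * (x k * r k ^ 2) else 0 := fun l => by
      split_ifs with h
      · subst h; ring
      · simp only [Sym2.lift_mk]; ring
    simp only [this, sum_sub_distrib, sum_add_distrib, ← mul_sum, sum_ite_eq, mem_univ, if_true]
  rw [inner_eq_sum, sum_congr rfl fun e _ => h2 e]
  simp only [h3, sum_sub_distrib, sum_add_distrib, ← mul_sum, ← sum_mul] at h1
  linarith

/-- The inner product with `a_j` is the row sum times `(A x)_j`, minus the sum of the `x_k` with `k
≠ j`. The former gives `a b`, the latter `n²` by Cauchy–Schwarz, both times `∑ x_k² ≤ (2/n) ‖w‖²`.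
-/
lemma sum_inner_starVec_vertexSum_sq_le (hn : 6 ≤ n) {G : SimpleGraph (Fin n)} {a b : ℝ}
    (ha : ∀ j, (∑ k, signedAdj G j k) ^ 2 ≤ a)
    (hb : ∀ x : Fin n → ℝ, ∑ j, (∑ k, x k * signedAdj G j k) ^ 2 ≤ b * ∑ k, x k ^ 2)
    (ha0 : 0 ≤ a) (hb0 : 0 ≤ b) {w : PairSpace n} (hw : w ∈ vertexSums n) :
    ∑ j, inner ℝ (starVec G j) w ^ 2 ≤ 4 * (a * b / n + n) * ‖w‖ ^ 2 := by
  have hn' : (6 : ℝ) ≤ n := by exact_mod_cast hn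
  obtain ⟨x, hx⟩ := hw
  set X := ∑ k, x k ^ 2 with hX
  have hX0 : 0 ≤ X := sum_nonneg fun k _ => sq_nonneg _
  have h1 : ∀ j, (∑ k, x k * signedAdj G j k ^ 2) ^ 2 ≤ n * X := fun j => by
    refine (sum_mul_sq_le_sq_mul_sq _ _ _).trans ?_
    rw [mul_comm]
    gcongr
    have : ∀ k ∈ univ, (signedAdj G j k ^ 2) ^ 2 ≤ 1 := fun k _ => by
      rcases eq_or_ne j k with rfl | hk
      · simp [signedAdj_self]
      · rw [sq (signedAdj G j k), signedAdj_sq G hk]; simp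
    simpa using sum_le_sum this
  have h2 : ∑ j, inner ℝ (starVec G j) w ^ 2 ≤ 2 * (a * (b * X)) + 2 * (n * (n * X)) := by
    calc _ ≤ ∑ j, (2 * (a * (∑ k, x k * signedAdj G j k) ^ 2) + 2 * (n * X)) := by
          refine sum_le_sum fun j _ => ?_
          rw [inner_starVec_vertexSum G j hx]
          have h3 := mul_le_mul_of_nonneg_right (ha j)
            (sq_nonneg (∑ k, x k * signedAdj G j k))
          rw [← mul_pow] at h3
          nlinarith [h1 j, sq_nonneg ((∑ k, signedAdj G j k) * ∑ k, x k * signedAdj G j k +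
            ∑ k, x k * signedAdj G j k ^ 2)]
      _ = 2 * (a * ∑ j, (∑ k, x k * signedAdj G j k) ^ 2) + 2 * (n * (n * X)) := by
          rw [sum_add_distrib, ← mul_sum, ← mul_sum]
          simp; ring
      _ ≤ _ := by
          have := mul_le_mul_of_nonneg_left (hb x) ha0
          linarith
  have h3 : (n : ℝ) / 2 * X ≤ ‖w‖ ^ 2 := by
    have := norm_sq_vertexSum hx
    nlinarith
  calc _ ≤ _ := h2
    _ = 4 * (a * b / n + n) * (n / 2 * X) := by field_simp; ring
    _ ≤ _ := by gcongr

lemma sum_sq_le_inner_proj0 (u : PairSpace n) :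
    (∑ e, u e) ^ 2 ≤ n ^ 2 / 2 * inner ℝ (proj0 n u) u := by
  have h1 : inner ℝ u (onesVec n) = ∑ e, u e := by
    rw [inner_eq_sum]; exact sum_congr rfl fun e _ => by simp [onesVec]
  have hmem : onesVec n ∈ spaceV0 n := Submodule.mem_span_singleton_self _
  have h2 : inner ℝ (proj0 n u) (onesVec n) = inner ℝ u (onesVec n) := by
    have := (spaceV0 n).starProjection_inner_eq_zero u (onesVec n) hmem
    rw [inner_sub_left] at this
    exact (sub_eq_zero.1 this).symm
  have h3 : inner ℝ (proj0 n u) u = ‖proj0 n u‖ ^ 2 := inner_starProjection_self _ u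
  have h4 : ‖onesVec n‖ ^ 2 ≤ n ^ 2 / 2 := by
    have := two_mul_card_pairs (n := n)
    rw [norm_sq_eq_sum]
    simp only [onesVec, one_pow]
    have : (0 : ℝ) ≤ n := Nat.cast_nonneg n
    linarith
  rw [← h1, ← h2, h3]
  calc _ ≤ (‖proj0 n u‖ * ‖onesVec n‖) ^ 2 :=
        sq_le_sq.2 ((abs_real_inner_le_norm _ _).trans (le_abs_self _))
    _ = ‖onesVec n‖ ^ 2 * ‖proj0 n u‖ ^ 2 := by ring
    _ ≤ _ := by gcongr

/-- `a_i ∘ a_i` is the all-ones vector minus the indicator of the pairs containing `i`. Each vertex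
lies in at most `n` pairs and each pair contains two vertices, so weighted Cauchy–Schwarz bounds the
correction. -/
lemma sum_diag_sq_le (G : SimpleGraph (Fin n)) (u : PairSpace n) :
    ∑ i, (∑ e, u e * (pairProd (signedAdj G i) e * pairProd (signedAdj G i) e)) ^ 2 ≤
      2 * n * (∑ e, u e) ^ 2 + 4 * n * ‖u‖ ^ 2 := by
  classical
  set b : Fin n → Pairs n → ℝ := fun i e => 1 - pairProd (signedAdj G i) e ^ 2 with hb
  have hb0 : ∀ i e, 0 ≤ b i e := fun i e => sub_nonneg.2 (pairProd_signedAdj_sq_le G i e)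
  have hb1 : ∀ i e, b i e ≤ if i ∈ e.1 then 1 else 0 := fun i e => by
    split_ifs with h
    · simp only [hb]; linarith [sq_nonneg (pairProd (signedAdj G i) e)]
    · obtain ⟨k, l, hkl, -, rfl⟩ := e.exists_rep
      simp only [Sym2.mem_iff, not_or] at h
      simp only [hb, pairProd_mk, mul_pow]
      rw [sq, signedAdj_sq G h.1, sq, signedAdj_sq G h.2]; simp
  have hbsum : ∀ i, ∑ e, b i e ≤ n := fun i => by
    have h1 := two_mul_sum_pairProd_signedAdj_sq G i
    have h2 := two_mul_card_pairs (n := n)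
    simp only [hb, sum_sub_distrib]
    nlinarith
  have hbcol : ∀ e, ∑ i, b i e ≤ 2 := fun e => by
    refine (sum_le_sum fun i _ => hb1 i e).trans ?_
    obtain ⟨k, l, hkl, hne, rfl⟩ := e.exists_rep
    have : ∀ i, (if i ∈ (s(k, l) : Sym2 (Fin n)) then (1 : ℝ) else 0) ≤
        (if i = k then 1 else 0) + if i = l then 1 else 0 := fun i => by
      simp only [Sym2.mem_iff]
      split_ifs with h h1 h2 <;> first | (norm_num; done) | (exfalso; tauto)
    refine (sum_le_sum fun i _ => this i).trans ?_
    simp [sum_add_distrib]; norm_num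
  have hi : ∀ i, (∑ e, u e * (pairProd (signedAdj G i) e * pairProd (signedAdj G i) e)) ^ 2 ≤
      2 * (∑ e, u e) ^ 2 + 2 * (n * ∑ e, b i e * u e ^ 2) := fun i => by
    have h1 : ∑ e, u e * (pairProd (signedAdj G i) e * pairProd (signedAdj G i) e) =
        ∑ e, u e - ∑ e, b i e * u e := by
      rw [← sum_sub_distrib]
      exact sum_congr rfl fun e _ => by simp only [hb]; ring
    have h2 : (∑ e, b i e * u e) ^ 2 ≤ n * ∑ e, b i e * u e ^ 2 := by
      have h3 := sum_sq_le_sum_mul_sum_of_sq_le_mul univ (r := fun e => b i e * u e)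
        (f := fun e => b i e) (g := fun e => b i e * u e ^ 2) (fun e _ => hb0 i e)
        (fun e _ => mul_nonneg (hb0 i e) (sq_nonneg _)) (fun e _ => le_of_eq (by ring))
      refine h3.trans ?_
      gcongr
      · exact sum_nonneg fun e _ => mul_nonneg (hb0 i e) (sq_nonneg _)
      · exact hbsum i
    rw [h1]
    nlinarith [sq_nonneg (∑ e, u e + ∑ e, b i e * u e)]
  calc _ ≤ ∑ i, (2 * (∑ e, u e) ^ 2 + 2 * (n * ∑ e, b i e * u e ^ 2)) :=
        sum_le_sum fun i _ => hi i
    _ = 2 * n * (∑ e, u e) ^ 2 + 2 * (n * ∑ e, (∑ i, b i e) * u e ^ 2) := by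
        simp only [sum_mul]
        rw [sum_add_distrib, ← mul_sum, ← mul_sum, ← mul_sum, sum_comm]
        simp only [sum_const, card_univ, Fintype.card_fin, nsmul_eq_mul]
        ring
    _ ≤ 2 * n * (∑ e, u e) ^ 2 + 2 * (n * ∑ e, 2 * u e ^ 2) := by
        gcongr with e _
        exact hbcol e
    _ = _ := by rw [norm_sq_eq_sum, ← mul_sum]; ring

lemma proj2_eq : proj2 n = ContinuousLinearMap.id ℝ (PairSpace n) -
    (spaceV0 n ⊔ spaceV1 n).starProjection :=
  Submodule.starProjection_orthogonal' _

/-- The quadratic form of the conjugated projections, bounded in terms of the spectral data. -/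
lemma sum_norm_projW_sq_le (hn : 6 ≤ n) {G : SimpleGraph (Fin n)} {a b m : ℝ}
    (ha : ∀ j, (∑ k, signedAdj G j k) ^ 2 ≤ a)
    (hb : ∀ x : Fin n → ℝ, ∑ j, (∑ k, x k * signedAdj G j k) ^ 2 ≤ b * ∑ k, x k ^ 2)
    (ha0 : 0 ≤ a) (hb0 : 0 ≤ b)
    (hm : ∀ u : Pairs n → ℝ, ∑ j, ∑ i, (if i = j then 0 else
        (∑ e, u e * (pairProd (signedAdj G i) e * pairProd (signedAdj G j) e)) ^ 2) ≤
        m * ∑ e, u e ^ 2)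
    (hC : ∀ c : Fin n → ℝ, (∑ i, ∑ j, if i = j then 0 else c i * c j *
      ∑ e, pairProd (signedAdj G i) e * pairProd (signedAdj G j) e) ^ 2 ≤
      ((n : ℝ) ^ 2 / 8 * ∑ i, c i ^ 2) ^ 2) (u : PairSpace n) :
    ∑ i, ‖projW G (proj2 n (starDiag G i u))‖ ^ 2 ≤
      16 * n * inner ℝ (proj0 n u) u +
        16 / n ^ 2 * (m + 4 * n + n * (4 * (a * b / n + n))) * ‖u‖ ^ 2 := by
  have hn' : (6 : ℝ) ≤ n := by exact_mod_cast hn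
  set d := 4 * (a * b / n + n) with hd
  have hd0 : 0 ≤ d := by positivity
  set Q := (spaceV0 n ⊔ spaceV1 n).starProjection with hQ
  -- Splitting `Π₂ = Id - Q`; the `Q` part is uniform in `i`, and summing it over `i` costs a factor
  -- `n`.
  have h1 : ∀ i, ‖projW G (proj2 n (starDiag G i u))‖ ^ 2 ≤ 8 / n ^ 2 *
      (2 * ∑ j, inner ℝ (starVec G j) (starDiag G i u) ^ 2 + 2 * (d * ‖u‖ ^ 2)) := fun i => by
    refine (norm_projW_sq_le (by omega) (le_norm_sum_smul_starVec_sq hn hC) _).trans ?_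
    gcongr
    have h2 : ∑ j, inner ℝ (starVec G j) (Q (starDiag G i u)) ^ 2 ≤ d * ‖u‖ ^ 2 := by
      refine (sum_inner_starVec_vertexSum_sq_le hn ha hb ha0 hb0
        (spaceV0_sup_spaceV1_le (Submodule.starProjection_apply_mem _ _))).trans ?_
      refine mul_le_mul_of_nonneg_left (le_trans ?_ (norm_starDiag_sq_le G i u)) hd0
      gcongr
      exact Submodule.norm_starProjection_apply_le _ _
    calc _ ≤ ∑ j, (2 * inner ℝ (starVec G j) (starDiag G i u) ^ 2 +
          2 * inner ℝ (starVec G j) (Q (starDiag G i u)) ^ 2) := by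
          refine sum_le_sum fun j _ => ?_
          rw [proj2_eq, _root_.sub_apply, ContinuousLinearMap.id_apply,
            inner_sub_right]
          nlinarith [sq_nonneg (inner ℝ (starVec G j) (starDiag G i u) +
            inner ℝ (starVec G j) (Q (starDiag G i u)))]
      _ ≤ _ := by
          rw [sum_add_distrib, ← mul_sum, ← mul_sum]
          linarith
  have h3 : ∑ i, ∑ j, inner ℝ (starVec G j) (starDiag G i u) ^ 2 ≤
      m * ‖u‖ ^ 2 + (2 * n * (∑ e, u e) ^ 2 + 4 * n * ‖u‖ ^ 2) := by
    have h4 : ∀ i j, inner ℝ (starVec G j) (starDiag G i u) ^ 2 =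
        (if i = j then 0 else
          (∑ e, u e * (pairProd (signedAdj G i) e * pairProd (signedAdj G j) e)) ^ 2) +
        if i = j then
          (∑ e, u e * (pairProd (signedAdj G i) e * pairProd (signedAdj G i) e)) ^ 2 else 0 :=
      fun i j => by
        have : inner ℝ (starVec G j) (starDiag G i u) =
            ∑ e, u e * (pairProd (signedAdj G i) e * pairProd (signedAdj G j) e) := by
          rw [inner_eq_sum]
          exact sum_congr rfl fun e _ => by rw [starVec_apply, starDiag_apply]; ring
        rw [this]
        split_ifs with h
        · subst h; simp
        · simp
    simp only [h4, sum_add_distrib, sum_ite_eq, mem_univ, if_true]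
    refine add_le_add ?_ (sum_diag_sq_le G u)
    rw [sum_comm, norm_sq_eq_sum]
    exact hm u
  have h5 := sum_sq_le_inner_proj0 u
  calc _ ≤ ∑ i, 8 / (n : ℝ) ^ 2 *
      (2 * ∑ j, inner ℝ (starVec G j) (starDiag G i u) ^ 2 + 2 * (d * ‖u‖ ^ 2)) :=
        sum_le_sum fun i _ => h1 i
    _ = 8 / (n : ℝ) ^ 2 * (2 * ∑ i, ∑ j, inner ℝ (starVec G j) (starDiag G i u) ^ 2 +
          2 * (n * (d * ‖u‖ ^ 2))) := by
        rw [← mul_sum, sum_add_distrib, ← mul_sum]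
        simp only [sum_const, card_univ, Fintype.card_fin, nsmul_eq_mul]
        ring
    _ ≤ 8 / (n : ℝ) ^ 2 * (2 * (m * ‖u‖ ^ 2 + (2 * n * (n ^ 2 / 2 * inner ℝ (proj0 n u) u) +
          4 * n * ‖u‖ ^ 2)) + 2 * (n * (d * ‖u‖ ^ 2))) := by
        gcongr
        refine h3.trans ?_
        gcongr
    _ = _ := by field_simp; ring

lemma loewner_of_quadratic_form {G : SimpleGraph (Fin n)} {c d : ℝ}
    (h : ∀ u : PairSpace n, ∑ i, ‖projW G (proj2 n (starDiag G i u))‖ ^ 2 ≤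
      c * inner ℝ (proj0 n u) u + d * ‖u‖ ^ 2) :
    ∑ i : Fin n, starDiag G i ∘L proj2 n ∘L projW G ∘L proj2 n ∘L starDiag G i ≤
      c • proj0 n + d • ContinuousLinearMap.id ℝ (PairSpace n) := by
  have hp2 : ∀ u v : PairSpace n, inner ℝ (proj2 n u) v = inner ℝ u (proj2 n v) := fun u v =>
    Submodule.inner_starProjection_left_eq_right _ u v
  have hpW : ∀ u v : PairSpace n, inner ℝ (projW G u) v = inner ℝ u (projW G v) := fun u v =>
    Submodule.inner_starProjection_left_eq_right _ u v
  have hp0 : ∀ u v : PairSpace n, inner ℝ (proj0 n u) v = inner ℝ u (proj0 n v) := fun u v =>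
    Submodule.inner_starProjection_left_eq_right _ u v
  have hWW : ∀ u : PairSpace n, inner ℝ (projW G u) u = ‖projW G u‖ ^ 2 := fun u =>
    inner_starProjection_self _ u
  rw [ContinuousLinearMap.le_def, ContinuousLinearMap.isPositive_iff]
  constructor
  · intro u v
    simp only [ContinuousLinearMap.coe_coe, _root_.sub_apply,
      _root_.add_apply, _root_.smul_apply, ContinuousLinearMap.id_apply,
      _root_.sum_apply, ContinuousLinearMap.comp_apply, inner_sub_left,
      inner_sub_right, inner_add_left, inner_add_right, real_inner_smul_left,
      real_inner_smul_right, sum_inner, inner_sum, inner_starDiag_left, hp2, hpW, hp0]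
  · intro u
    have := h u
    simp only [_root_.sub_apply,
      _root_.add_apply, _root_.smul_apply, ContinuousLinearMap.id_apply,
      _root_.sum_apply, ContinuousLinearMap.comp_apply, inner_sub_left,
      inner_add_left, real_inner_smul_left, sum_inner, inner_starDiag_left, hp2, hWW,
      real_inner_self_eq_norm_sq]
    linarith

end Deterministic

end PlantedClique

/-! ### The main theorem: choice of moments and constants -/

open PlantedClique in
theorem lemma9 :
    ∃ C₀ C₁ C₂ : ℝ, ∀ n : ℕ, 1 ≤ n →
      1 - C₀ / (n : ℝ) ^ 5 ≤
        (randomGraph n).real {G : SimpleGraph (Fin n) |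
          ∑ i : Fin n, starDiag G i ∘L proj2 n ∘L projW G ∘L proj2 n ∘L starDiag G i ≤
            (C₁ * (n : ℝ)) • proj0 n +
              (C₂ * Real.log (n : ℝ) ^ 2) • ContinuousLinearMap.id ℝ (PairSpace n)} := by
  -- With `p = ⌈log n⌉` this gives `t ^ p ≥ n ^ 10`, which beats prefactors up to `2 n ^ 4` and
  -- leaves `n ^ (-5)`.
  set t : ℝ := Real.exp 10 with ht
  -- Normalizes the Gram bound at `p = 8` (`512 = 8 ^ 3`) and `t = n / D` to exactly `n ^ 4 / 64 =
  -- (n² / 8)²`.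
  set D : ℝ := 6561 * 2000 * 512 * 64 with hD
  refine ⟨6 ^ 5 + 5 + 2 * D ^ 8, 16,
    16 * (6561 * 48 * t + 1 + 4 * 81 * 144 * t ^ 2 + 4), fun n hn => ?_⟩
  have hD0 : 0 < D := by norm_num [hD]
  have ht0 : 0 < t := Real.exp_pos 10
  -- For `n < 6` the summand `6 ^ 5` of `C₀` makes the claimed lower bound nonpositive.
  rcases lt_or_ge n 6 with h6 | h6
  · refine le_trans ?_ MeasureTheory.measureReal_nonneg
    have hn0 : (0 : ℝ) < n := by exact_mod_cast hn
    have hn6 : (n : ℝ) ^ 5 ≤ 6 ^ 5 := by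
      gcongr; exact_mod_cast h6.le
    rw [sub_nonpos, le_div_iff₀ (by positivity)]
    have : 0 < D ^ 8 := by positivity
    linarith
  have hn6 : (6 : ℝ) ≤ n := by exact_mod_cast h6
  have hn0 : (0 : ℝ) < n := by linarith
  set L := Real.log n with hL
  have hL1 : 1 ≤ L := by
    rw [hL, Real.le_log_iff_exp_le hn0]
    linarith [Real.exp_one_lt_d9]
  set p : ℕ := ⌈L⌉₊ with hp
  have hLp : L ≤ p := Nat.le_ceil L
  have hpL : (p : ℝ) ≤ 2 * L := by
    have := (Nat.ceil_lt_add_one (by linarith : (0 : ℝ) ≤ L)).le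
    linarith
  have hp1 : 1 ≤ p := by exact_mod_cast hL1.trans hLp
  have htp : (n : ℝ) ^ 10 ≤ t ^ p := by
    calc (n : ℝ) ^ 10 = Real.exp (10 * L) := by
          rw [show (10 : ℝ) * L = (10 : ℕ) * L by norm_num, Real.exp_nat_mul, hL,
            Real.exp_log hn0]
      _ ≤ Real.exp (p * 10) := by rw [Real.exp_le_exp]; linarith
      _ = t ^ p := by rw [Real.exp_nat_mul]
  have e1 := randomGraph_real_adj_norm_le hp1 hn ht0
  have e2 := randomGraph_real_prod_norm_le hp1 hn ht0
  have e3 := randomGraph_real_row_sum_le hp1 hn ht0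
  -- The Gram form has a full factor `n` of slack, so a fixed moment suffices and no logarithm is
  -- lost; eight is what turns `n ^ 3` into `n ^ (-5)`.
  have e4 := randomGraph_real_cross_norm_le (p := 8) (by norm_num) hn (div_pos hn0 hD0)
  set B₁ := {G : SimpleGraph (Fin n) | ¬ ∀ x : Fin n → ℝ,
      ∑ j, (∑ k, x k * signedAdj G j k) ^ 2 ≤ 81 * (t * (6 * p * n)) * ∑ k, x k ^ 2} with hB₁
  set B₂ := {G : SimpleGraph (Fin n) | ¬ ∀ u : Pairs n → ℝ,
      ∑ j, ∑ i, (if i = j then 0 else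
        (∑ e, u e * (pairProd (signedAdj G i) e * pairProd (signedAdj G j) e)) ^ 2) ≤
        6561 * (t * (12 * p ^ 2 * n ^ 2)) * ∑ e, u e ^ 2} with hB₂
  set B₃ := {G : SimpleGraph (Fin n) | ¬ ∀ j, (∑ k, signedAdj G j k) ^ 2 ≤ t * (6 * p * n)}
    with hB₃
  set B₄ := {G : SimpleGraph (Fin n) | ¬ ∀ c : Fin n → ℝ,
      (∑ i, ∑ j, if i = j then 0 else c i * c j *
        ∑ e, pairProd (signedAdj G i) e * pairProd (signedAdj G j) e) ^ 2 ≤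
        6561 * (n / D * (2000 * (8 : ℕ) ^ 3 * n ^ 3)) * (∑ i, c i ^ 2) ^ 2} with hB₄
  set S := {G : SimpleGraph (Fin n) |
          ∑ i : Fin n, starDiag G i ∘L proj2 n ∘L projW G ∘L proj2 n ∘L starDiag G i ≤
            (16 * (n : ℝ)) • proj0 n +
              (16 * (6561 * 48 * t + 1 + 4 * 81 * 144 * t ^ 2 + 4) * L ^ 2) •
                ContinuousLinearMap.id ℝ (PairSpace n)} with hS
  have hsub : Sᶜ ⊆ (B₁ ∪ B₂) ∪ (B₃ ∪ B₄) := by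
    intro G hG
    by_contra hB
    simp only [Set.mem_union, not_or, hB₁, hB₂, hB₃, hB₄, Set.mem_ofPred_eq, not_not] at hB
    obtain ⟨⟨h1, h2⟩, h3, h4⟩ := hB
    refine hG (loewner_of_quadratic_form fun u => ?_)
    have hpn : 6 * (p : ℝ) * n ≤ 12 * L * n := by
      have := mul_le_mul_of_nonneg_right hpL hn0.le
      linarith
    set a := t * (12 * L * n) with ha
    have ha0 : 0 ≤ a := by positivity
    have hpa : t * (6 * p * n) ≤ a := mul_le_mul_of_nonneg_left hpn ht0.le
    have hm : 6561 * (t * (12 * (p : ℝ) ^ 2 * n ^ 2)) ≤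
        6561 * (t * (12 * (2 * L) ^ 2 * n ^ 2)) := by
      gcongr
    have key := sum_norm_projW_sq_le h6 (G := G) (a := a) (b := 81 * a)
      (m := 6561 * (t * (12 * (2 * L) ^ 2 * n ^ 2)))
      (fun j => (h3 j).trans hpa)
      (fun x => (h1 x).trans (by
        have : 0 ≤ ∑ k, x k ^ 2 := Finset.sum_nonneg fun k _ => sq_nonneg _
        gcongr)) ha0 (by positivity)
      (fun u => (h2 u).trans (by
        have : 0 ≤ ∑ k, u k ^ 2 := Finset.sum_nonneg fun k _ => sq_nonneg _
        gcongr))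
      (fun c => (h4 c).trans (le_of_eq (by rw [hD]; push_cast; field_simp; ring))) u
    refine key.trans (add_le_add le_rfl (mul_le_mul_of_nonneg_right ?_ (sq_nonneg _)))
    rw [ha]
    have hL2 : 1 ≤ L ^ 2 := one_le_pow₀ hL1
    have h5 : 4 * (n : ℝ) ≤ n ^ 2 * L ^ 2 := by nlinarith
    have h7 : 4 * (n : ℝ) ^ 2 ≤ 4 * n ^ 2 * L ^ 2 := by nlinarith [sq_nonneg (n : ℝ)]
    rw [div_mul_eq_mul_div, div_le_iff₀ (by positivity)]
    -- Row sums and operator norm each contribute one logarithm here, giving `n² log² n` before the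
    -- division by `n²`.
    have h8 : (n : ℝ) * (4 * (t * (12 * L * n) * (81 * (t * (12 * L * n))) / n + n)) =
        4 * 81 * 144 * t ^ 2 * (n ^ 2 * L ^ 2) + 4 * n ^ 2 := by field_simp; ring
    rw [h8]
    nlinarith
  have hbound : (randomGraph n).real Sᶜ ≤ (6 ^ 5 + 5 + 2 * D ^ 8) / (n : ℝ) ^ 5 := by
    have hu : (randomGraph n).real Sᶜ ≤ (n / t ^ p + 2 * n ^ 4 / t ^ p) +
        (2 * n / t ^ p + 2 * n ^ 3 / (n / D) ^ 8) :=
      (MeasureTheory.measureReal_mono hsub).trans ((MeasureTheory.measureReal_union_le _ _).trans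
        (add_le_add ((MeasureTheory.measureReal_union_le _ _).trans (add_le_add e1 e2))
          ((MeasureTheory.measureReal_union_le _ _).trans (add_le_add e3 e4))))
    have h1 : ∀ x : ℝ, 0 ≤ x → x ≤ 2 * (n : ℝ) ^ 4 → x / t ^ p ≤ 1 / (n : ℝ) ^ 5 := by
      intro x hx hxn
      rw [div_le_div_iff₀ (by positivity) (by positivity), one_mul]
      calc x * (n : ℝ) ^ 5 ≤ (2 * n ^ 4) * n ^ 5 := by gcongr
        _ = 2 * (n : ℝ) ^ 9 := by ring
        _ ≤ n * (n : ℝ) ^ 9 := by gcongr; linarith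
        _ = (n : ℝ) ^ 10 := by ring
        _ ≤ t ^ p := htp
    have hn4 : (n : ℝ) ≤ n ^ 4 := le_self_pow₀ (by linarith) (by norm_num)
    have h2 := h1 n hn0.le (by linarith)
    have h3 := h1 (2 * n ^ 4) (by positivity) le_rfl
    have h4 := h1 (2 * n) (by positivity) (by linarith)
    have h5 : 2 * (n : ℝ) ^ 3 / (n / D) ^ 8 = 2 * D ^ 8 / n ^ 5 := by field_simp
    rw [h5] at hu
    calc _ ≤ 1 / (n : ℝ) ^ 5 + 1 / (n : ℝ) ^ 5 + (1 / (n : ℝ) ^ 5 + 2 * D ^ 8 / n ^ 5) := by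
          linarith
      _ = (3 + 2 * D ^ 8) / (n : ℝ) ^ 5 := by ring
      _ ≤ _ := by gcongr; norm_num
  have hms := measurableSingletonClass_simpleGraph (n := n)
  have hc := MeasureTheory.probReal_compl_eq_one_sub (μ := randomGraph n)
    (Set.toFinite S).measurableSet
  linarith
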